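/- Let $\lambda,\tau,P,\Delta h>0$, let $N\ge 1$, let $0=R_0<R_1<\dots<R_{N-1}<R_N=\infty$ and $0\le\alpha_0\le\dots\le\alpha_{N-1}$ with $\alpha_{N-1}>2$, and put $K_n=\prod_{i=1}^{n}R_i^{\alpha_i-\alpha_{i-1}}$ (so $K_0=1$) and $\bar R_n=\sqrt{R_n^2+\Delta h^2}$. Base stations form a homogeneous Poisson point process of density $\lambda$ in $\mathbb R^2$. A base station at horizontal distance $r$ from the user has antenna distance $d=\sqrt{r^2+\Delta h^2}$ to the user and path loss $l_N=K_n d^{-\alpha_n}$ if $R_n\le r<R_{n+1}$ (equivalently $\bar R_n\le d<\bar R_{n+1}$). The channel coefficients from the base stations to the user are i.i.d. $\mathcal{CN}(0,1)$ and independent of the positions; $P$ is the transmit power. The user, at a fixed point, is served by the nearest base station, $\mathsf{SIR}$ is the ratio of the power $P|h_0|^2l_N$ received from it to the sum of the powers received from all other base stations, the coverage probability is $\mathsf{CP}_N(\lambda)=\mathbb P\{\mathsf{SIR}>\tau\}$ and the network spatial throughput is $\mathsf{ST}_N(\lambda)=\lambda\,\mathbb P\{\mathsf{SIR}>\tau\}\log_2(1+\tau)$.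 Let ${}_2F_1$ be the Gaussian hypergeometric function (principal branch), $\omega_1(x,y)={}_2F_1(1,1-\frac2y;2-\frac2y;-x)$, $\omega_2(x,y)={}_2F_1(1,\frac2y;1+\frac2y;-x)$ (with the limit value $\omega_2(x,0)=\frac1{1+x}$) and $\delta(x,y)=\frac{2x\,\omega_1(x,y)}{y-2}$. Then $\mathsf{ST}_N(\lambda)=\lambda\,\mathsf{CP}_N(\lambda)\log_2(1+\tau)$; the horizontal distance $r_0$ from the user to its nearest base station has the contact density $f_{r_0}(x)=2\pi\lambda x\,e^{-\pi\lambda x^2}$, $x\ge0$; and, with $d_0=\sqrt{r_0^2+\Delta h^2}$, the following holds. If $N=1$, $$\mathsf{CP}_1(\lambda)=\frac{1}{1+\delta(\tau,\alpha_0)}\exp\!\left(-\pi\lambda\,\delta(\tau,\alpha_0)\,\Delta h^2\right).$$ If $N>1$, $$\mathsf{CP}_N(\lambda)=\sum_{n=0}^{N-1}\mathbb E_{r_0\in[R_n,R_{n+1})}\Bigg\{\exp\Bigg[-\pi\lambda\Bigg(\bar R_{n+1}^2\,\omega_2\Big(\tfrac{\bar R_{n+1}^{\alpha_n}}{\tau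 d_0^{\alpha_n}},\alpha_n\Big)-d_0^2\,\omega_2(\tau^{-1},\alpha_n)+\sum_{i=n+1}^{N-1}\Big(\bar R_{i+1}^2\,\omega_2\Big(\tfrac{\bar R_{i+1}^{\alpha_i}}{\tau\frac{K_i}{K_n}d_0^{\alpha_n}},\alpha_i\Big)-\bar R_i^2\,\omega_2\Big(\tfrac{\bar R_i^{\alpha_i}}{\tau\frac{K_i}{K_n}d_0^{\alpha_n}},\alpha_i\Big)\Big)\Bigg)\Bigg]\Bigg\},$$ where $\mathbb E_{r_0\in[a,b)}\{g(r_0)\}=\int_a^b g(x)f_{r_0}(x)\,dx$, all these integrals are finite, and a term containing $\bar R_N=\infty$ stands for its limit as $\bar R_N\to\infty$, which exists. -/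

import Mathlib

open MeasureTheory ProbabilityTheory Filter Topology
open scoped ENNReal NNReal

noncomputable section

namespace SmallCell

/-! ### The Gaussian hypergeometric function and the functions built from it -/

/-- The plane cut along `[1, ∞)`, the domain of the principal branch of `₂F₁`. -/
def cutPlane : Set ℂ := {z | 1 - z ∈ Complex.slitPlane}

/-- `f` is the principal branch of the Gaussian hypergeometric function with parameters `a, b, c`:
it is analytic on `ℂ ∖ [1, ∞)` and is given by the hypergeometric series on the unit disc. -/
def IsGaussHypergeometric (a b c : ℂ) (f : ℂ → ℂ) : Prop :=
  AnalyticOnNhd ℂ f cutPlane ∧ ∀ z : ℂ, ‖z‖ < 1 → f z = ordinaryHypergeometric a b c z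

/-- The principal branch is unique. -/
theorem IsGaussHypergeometric.eqOn {a b c : ℂ} {f g : ℂ → ℂ}
    (hf : IsGaussHypergeometric a b c f) (hg : IsGaussHypergeometric a b c g) :
    Set.EqOn f g cutPlane := by
  have hpre : IsPreconnected cutPlane := by
    have h1 : cutPlane = (fun z : ℂ => 1 - z) '' Complex.slitPlane := by
      ext z
      constructor
      · intro hz
        exact ⟨1 - z, hz, by ring⟩
      · rintro ⟨w, hw, rfl⟩
        simpa [cutPlane] using hw
    rw [h1]
    refine IsPreconnected.image ?_ _ (by fun_prop)
    exact (Complex.starConvex_one_slitPlane.isPathConnected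
      (by simp)).isConnected.isPreconnected
  refine hf.1.eqOn_of_preconnected_of_eventuallyEq hg.1 hpre (z₀ := 0) (by simp [cutPlane]) ?_
  filter_upwards [Metric.ball_mem_nhds (0 : ℂ) one_pos] with z hz
  have hz' : ‖z‖ < 1 := by simpa using hz
  rw [hf.2 z hz', hg.2 z hz']

open Classical in
/-- The Gaussian hypergeometric function `₂F₁(a, b; c; z)` on `ℂ ∖ [1, ∞)`, by analytic
continuation of the hypergeometric series. -/
def gauss2F1 (a b c : ℂ) : ℂ → ℂ :=
  if h : ∃ f : ℂ → ℂ, IsGaussHypergeometric a b c f then h.choose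
  else ordinaryHypergeometric a b c

/-- `ω₁(x, y) = ₂F₁(1, 1 - 2/y; 2 - 2/y; -x)`. -/
def omega1 (x y : ℝ) : ℝ :=
  (gauss2F1 1 ((1 - 2 / y : ℝ) : ℂ) ((2 - 2 / y : ℝ) : ℂ) ((-x : ℝ) : ℂ)).re

/-- `ω₂(x, y) = ₂F₁(1, 2/y; 1 + 2/y; -x)` for `y > 0`; at `y = 0` the limit value `1 / (1 + x)`
as `y → 0+` is taken. -/
def omega2 (x y : ℝ) : ℝ :=
  if y = 0 then 1 / (1 + x)
  else (gauss2F1 1 ((2 / y : ℝ) : ℂ) ((1 + 2 / y : ℝ) : ℂ) ((-x : ℝ) : ℂ)).re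

/-- `δ(x, y) = 2 x ω₁(x, y) / (y - 2)`. -/
def delta (x y : ℝ) : ℝ := 2 * x * omega1 x y / (y - 2)

/-! ### The multi-slope path-loss model with antenna height difference -/

/-- Admissible parameters of the `N`-slope model: `0 = R₀ < R₁ < ⋯ < R_{N-1} (< R_N = ∞)` and
`0 ≤ α₀ ≤ α₁ ≤ ⋯ ≤ α_{N-1}` with `α_{N-1} > 2`. Only `R n`, `α n` with `n < N` matter. -/
structure IsMultiSlope (N : ℕ) (α R : ℕ → ℝ) : Prop where
  one_le : 1 ≤ N
  R_zero : R 0 = 0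
  R_lt : ∀ n, n + 1 < N → R n < R (n + 1)
  α_zero : 0 ≤ α 0
  α_le : ∀ n, n + 1 < N → α n ≤ α (n + 1)
  α_last : 2 < α (N - 1)

/-- The `n`-th slope region `[R_n, R_{n+1})` of horizontal distances, where `R_N = ∞`. -/
def slopeRegion (N : ℕ) (R : ℕ → ℝ) (n : ℕ) : Set ℝ :=
  {r | R n ≤ r ∧ (n + 1 < N → r < R (n + 1))}

/-- `K_n = ∏_{i=1}^n R_i ^ (α_i - α_{i-1})`, so `K₀ = 1`. -/
def slopeCoeff (α R : ℕ → ℝ) (n : ℕ) : ℝ :=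
  ∏ i ∈ Finset.Icc 1 n, R i ^ (α i - α (i - 1))

/-- Distance between the antennas at horizontal distance `r`, for height difference `Δh`. -/
def antennaDist (Δh r : ℝ) : ℝ := √(r ^ 2 + Δh ^ 2)

/-- Path loss of a link of horizontal distance `r ≥ 0`: it is `K_n d ^ (-α_n)` when `r` lies in the
`n`-th slope region, where `d` is the antenna distance. -/
def pathLoss (N : ℕ) (α R : ℕ → ℝ) (Δh r : ℝ) : ℝ :=
  ∑ n ∈ Finset.range N, (slopeRegion N R n).indicator
    (fun r => slopeCoeff α R n * antennaDist Δh r ^ (-α n)) r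

/-! ### The stochastic network -/

/-- The plane with its Euclidean distance and Lebesgue measure. -/
abbrev Plane : Type := EuclideanSpace ℝ (Fin 2)

variable {Ω : Type*} [MeasurableSpace Ω]

/-- The number of points of the configuration `X` in `B`. -/
def pointCount (X : ℕ → Ω → Plane) (B : Set Plane) (ω : Ω) : ℕ∞ :=
  {i : ℕ | X i ω ∈ B}.encard

/-- The points `X₀, X₁, …` form a homogeneous Poisson point configuration of density `lam`: the
number of points in a Borel set `B` of finite area is Poisson with mean `lam · |B|`, and the numbers
of points in disjoint such sets are independent. -/
structure IsHomogeneousPPP (μ : Measure Ω) (lam : ℝ) (X : ℕ → Ω → Plane) : Prop where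
  measurable : ∀ i, Measurable (X i)
  hasLaw_count : ∀ B : Set Plane, MeasurableSet B → volume B ≠ ∞ →
    HasLaw (pointCount X B)
      ((poissonMeasure (lam * volume.real B).toNNReal).map (fun k : ℕ => (k : ℕ∞))) μ
  iIndepFun_count : ∀ (m : ℕ) (B : Fin m → Set Plane), (∀ k, MeasurableSet (B k)) →
    (∀ k, volume (B k) ≠ ∞) → Pairwise (fun k l => Disjoint (B k) (B l)) →
    iIndepFun (fun k => pointCount X (B k)) μ

/-- The standard complex normal distribution `CN(0, 1)`: independent real and imaginary parts,
each normal with mean `0` and variance `1/2`. -/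
def complexNormal : Measure ℂ :=
  ((gaussianReal 0 (1 / 2)).prod (gaussianReal 0 (1 / 2))).map
    (fun p : ℝ × ℝ => (p.1 : ℂ) + (p.2 : ℂ) * Complex.I)

/-- The single-antenna downlink network: base stations at the points of a Poisson configuration `X`
of density `lam`, and channel coefficients `h i` from base station `i` to the user which are i.i.d.
`CN(0, 1)` and independent of the positions. -/
structure IsNetwork (μ : Measure Ω) (lam : ℝ) (X : ℕ → Ω → Plane) (h : ℕ → Ω → ℂ) : Prop where
  ppp : IsHomogeneousPPP μ lam X
  hasLaw_channel : ∀ i, HasLaw (h i) complexNormal μ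
  iIndepFun_channel : iIndepFun h μ
  indepFun : IndepFun (fun ω i => X i ω) (fun ω i => h i ω) μ

/-- Power received by the user at `u` from base station `i`, with transmit power `P` and path
loss `l` (a function of the horizontal distance). -/
def receivedPower (X : ℕ → Ω → Plane) (h : ℕ → Ω → ℂ) (u : Plane) (P : ℝ) (l : ℝ → ℝ)
    (i : ℕ) (ω : Ω) : ℝ≥0∞ :=
  ENNReal.ofReal (P * ‖h i ω‖ ^ 2 * l (dist (X i ω) u))

/-- Signal-to-interference ratio of the user at `u` if it is served by base station `i`. -/
def sir (X : ℕ → Ω → Plane) (h : ℕ → Ω → ℂ) (u : Plane) (P : ℝ) (l : ℝ → ℝ)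
    (i : ℕ) (ω : Ω) : ℝ≥0∞ :=
  receivedPower X h u P l i ω / ∑' j : {j : ℕ // j ≠ i}, receivedPower X h u P l j ω

/-- Base station `i` is the nearest one to `u`. -/
def IsServing (X : ℕ → Ω → Plane) (u : Plane) (i : ℕ) (ω : Ω) : Prop :=
  ∀ j, dist (X i ω) u ≤ dist (X j ω) u

/-- Coverage probability: the probability that the signal-to-interference ratio with respect to the
nearest base station exceeds the threshold `τ`. -/
def coverageProb (μ : Measure Ω) (X : ℕ → Ω → Plane) (h : ℕ → Ω → ℂ) (u : Plane) (P : ℝ)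
    (l : ℝ → ℝ) (τ : ℝ) : ℝ :=
  μ.real {ω | ∃ i, IsServing X u i ω ∧ ENNReal.ofReal τ < sir X h u P l i ω}

/-- Network spatial throughput `ℙ(SIR > τ) · lam · log₂(1 + τ)`. -/
def spatialThroughput (μ : Measure Ω) (lam : ℝ) (X : ℕ → Ω → Plane) (h : ℕ → Ω → ℂ) (u : Plane)
    (P : ℝ) (l : ℝ → ℝ) (τ : ℝ) : ℝ :=
  lam * coverageProb μ X h u P l τ * Real.logb 2 (1 + τ)

/-- The contact distribution: density `2 π lam x exp (-π lam x²)` on `x ≥ 0`. -/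
def contactLaw (lam : ℝ) : Measure ℝ :=
  (volume.restrict (Set.Ici 0)).withDensity
    (fun x => ENNReal.ofReal (2 * Real.pi * lam * x * Real.exp (-Real.pi * lam * x ^ 2)))

/-! ### The expressions in the coverage formula -/

/-- `S² ω₂(S^a / c, a)`. -/
def boundaryTerm (c a S : ℝ) : ℝ := S ^ 2 * omega2 (S ^ a / c) a

/-- The value of `boundaryTerm c α_i` at the upper end `√(R_{i+1}² + Δh²)` of slope `i`. For the
last slope this end is `∞` and the value is the limit. -/
def upperTerm (N : ℕ) (α R : ℕ → ℝ) (Δh : ℝ) (i : ℕ) (c : ℝ) : ℝ :=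
  if i + 1 < N then boundaryTerm c (α i) (antennaDist Δh (R (i + 1)))
  else limUnder atTop (boundaryTerm c (α i))

/-- The bracket in the exponent of the coverage formula, for a serving base station in slope
region `n` at antenna distance `d`. -/
def coverageExponent (N : ℕ) (α R : ℕ → ℝ) (Δh τ : ℝ) (n : ℕ) (d : ℝ) : ℝ :=
  upperTerm N α R Δh n (τ * d ^ α n) - d ^ 2 * omega2 τ⁻¹ (α n)
    + ∑ i ∈ Finset.Ico (n + 1) N,
        (upperTerm N α R Δh i (τ * (slopeCoeff α R i / slopeCoeff α R n) * d ^ α n)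
          - boundaryTerm (τ * (slopeCoeff α R i / slopeCoeff α R n) * d ^ α n) (α i)
              (antennaDist Δh (R i)))

/-- The function of `r₀` whose expectation over slope region `n` enters the coverage formula. -/
def coverageIntegrand (N : ℕ) (α R : ℕ → ℝ) (Δh lam τ : ℝ) (n : ℕ) (r₀ : ℝ) : ℝ :=
  Real.exp (-Real.pi * lam * coverageExponent N α R Δh τ n (antennaDist Δh r₀))

end SmallCell

end

/-! The power gain `‖h i‖ ^ 2` of a `CN(0, 1)` channel is exponential with mean 1. Fix the
positions, with nearest distance `r`. Then `SIR > τ` says that the serving gain exceeds an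
independent weighted sum of the other gains, so its probability is the product over the interferers,
at distances `t`, of `1 / (1 + τ l(t) / l(r))`. This is `exp (-∑ G(r, t))` with `G(r, t) = log (1 +
τ l(t) / l(r))` (`measure_ratio_gt`).

Averaging over the positions needs the points beyond the nearest one, jointly with its distance `D`.
This is extracted from the Laplace functional (`IsHomogeneousPPP.laplace`) taken with values in `[0,
∞]`: a test function equal to `∞` on a disc turns `exp (-∑)` into the indicator that the disc is
empty. Hence the points beyond `b` are independent of the event `a ≤ D < b`, and refining dyadic
intervals around `D` gives `IsHomogeneousPPP.laplace_beyond_nearest`: the average is that of `exp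
(-∫ (1 - exp (-G(r, t))) 2πλt dt)` over `t > r`, with `r` contact distributed. The refinement needs
`G` increasing in `r` and continuous at almost every `r`, and both follow from the path loss being
antitone. Since `Δh > 0`, the path loss may be discontinuous at the `R_n`, but it only jumps
downwards there.

It remains to evaluate the exponent. On slope `k` one has `1 - exp (-G) = 1 / (1 + s ^ α_k / c_k)`,
where `s` is the antenna distance and `t dt = s ds`. Euler's integral for `₂F₁(1, b; 1 + b; ·)`
shows that `s² ω₂(s ^ a / c, a)` is a primitive of `2 s / (1 + s ^ a / c)`
(`hasDerivAt_boundaryTerm`), and that for `a > 2` the integral from `S` to `∞` is `S² δ(c / S ^ a,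
a)`, so the limits at infinity exist. Adding up the slopes gives the general formula. For one slope
the exponent is `πλ d₀² δ(τ, α₀)`, and the average over `r₀` is explicit. -/

noncomputable section

namespace SmallCell

/-! ### The Laplace functional of a Poisson configuration. -/

section

/-- The function `x ↦ exp (-x)` on `[0, ∞]`. -/
def expNeg (x : ℝ≥0∞) : ℝ≥0∞ := EReal.exp (-(x : EReal))

@[simp] lemma expNeg_zero : expNeg 0 = 1 := by simp [expNeg]

@[simp] lemma expNeg_top : expNeg ∞ = 0 := by simp [expNeg]

lemma expNeg_eq_inv (x : ℝ≥0∞) : expNeg x = (EReal.exp x)⁻¹ := EReal.exp_neg _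

lemma expNeg_add (x y : ℝ≥0∞) : expNeg (x + y) = expNeg x * expNeg y := by
  rw [expNeg_eq_inv, expNeg_eq_inv, expNeg_eq_inv, EReal.coe_ennreal_add, EReal.exp_add,
    ENNReal.mul_inv (.inl ?_) (.inr ?_)] <;>
    simp only [ne_eq, EReal.exp_eq_zero_iff, EReal.coe_ennreal_ne_bot, not_false_eq_true]

lemma expNeg_ofReal {x : ℝ} (hx : 0 ≤ x) :
    expNeg (ENNReal.ofReal x) = ENNReal.ofReal (Real.exp (-x)) := by
  rw [expNeg, EReal.coe_ennreal_ofReal, max_eq_left hx, ← EReal.coe_neg, EReal.exp_coe]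

lemma expNeg_antitone : Antitone expNeg := fun x y h =>
  EReal.exp_monotone (by simpa using h)

lemma expNeg_le_one (x : ℝ≥0∞) : expNeg x ≤ 1 := by
  simpa using expNeg_antitone (zero_le (a := x))

lemma expNeg_ne_top (x : ℝ≥0∞) : expNeg x ≠ ∞ := ((expNeg_le_one x).trans_lt (by simp)).ne

lemma continuous_expNeg : Continuous expNeg :=
  ENNReal.continuous_exp.comp (continuous_neg.comp continuous_coe_ennreal_ereal)

@[fun_prop]
lemma measurable_expNeg : Measurable expNeg := continuous_expNeg.measurable

lemma expNeg_sum {ι : Type*} (s : Finset ι) (f : ι → ℝ≥0∞) :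
    expNeg (∑ i ∈ s, f i) = ∏ i ∈ s, expNeg (f i) := by
  classical
  induction s using Finset.induction_on with
  | empty => simp
  | insert a s ha ih => rw [Finset.sum_insert ha, Finset.prod_insert ha, expNeg_add, ih]

lemma expNeg_mul_nat (c : ℝ≥0∞) (k : ℕ) : expNeg (c * k) = expNeg c ^ k := by
  induction k with
  | zero => simp
  | succ k ih => rw [Nat.cast_succ, mul_add, mul_one, expNeg_add, ih, pow_succ]

/-- The probability generating function of the Poisson distribution. -/
lemma lintegral_pow_poissonMeasure (r : ℝ≥0) {z : ℝ≥0∞} (hz : z ≤ 1) :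
    ∫⁻ k, z ^ k ∂(poissonMeasure r) = expNeg ((1 - z) * r) := by
  obtain ⟨z, rfl⟩ : ∃ w : ℝ≥0, z = w :=
    ⟨z.toNNReal, (ENNReal.coe_toNNReal (ne_top_of_le_ne_top (by simp) hz)).symm⟩
  have hz' : z ≤ 1 := by exact_mod_cast hz
  rw [lintegral_countable']
  have h1 : ∀ k : ℕ, (z : ℝ≥0∞) ^ k * poissonMeasure r {k}
      = ENNReal.ofReal (Real.exp (-r) * ((z * r : ℝ) ^ k / (k.factorial : ℝ))) := by
    intro k
    rw [poissonMeasure_singleton, ← ENNReal.ofReal_coe_nnreal, ← ENNReal.ofReal_pow (by positivity),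
      ← ENNReal.ofReal_mul (by positivity)]
    congr 1
    rw [mul_pow]
    ring
  have h2 : HasSum (fun k : ℕ => Real.exp (-r) * ((z * r : ℝ) ^ k / (k.factorial : ℝ)))
      (Real.exp (-r) * Real.exp (z * r)) := by
    have := (NormedSpace.expSeries_div_hasSum_exp (𝔸 := ℝ) (z * r : ℝ)).mul_left (Real.exp (-r))
    rwa [← Real.exp_eq_exp_ℝ] at this
  simp_rw [h1]
  rw [← ENNReal.ofReal_tsum_of_nonneg (fun k => by positivity) h2.summable, h2.tsum_eq,
    ← Real.exp_add]
  have h3 : (1 - (z : ℝ≥0∞)) * r = ENNReal.ofReal ((1 - z) * r : ℝ) := by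
    rw [ENNReal.ofReal_mul (by simpa using hz'), ENNReal.ofReal_sub _ (by positivity)]
    simp
  rw [h3, expNeg_ofReal (mul_nonneg (by simpa using hz') (by positivity))]
  congr 2
  ring

variable {Ω : Type*}

lemma tsum_indicator_const_eq (X : ℕ → Ω → Plane) (B : Set Plane) (c : ℝ≥0∞) (ω : Ω) :
    ∑' i, B.indicator (fun _ => c) (X i ω) = c * (pointCount X B ω : ℝ≥0∞) := by
  have : ∀ i, B.indicator (fun _ => c) (X i ω)
      = c * ({i | X i ω ∈ B} : Set ℕ).indicator (fun _ => 1) i := by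
    intro i
    by_cases h : X i ω ∈ B <;> simp [h]
  simp_rw [this]
  rw [ENNReal.tsum_mul_left, ← tsum_subtype, ENNReal.tsum_set_one]
  rfl

variable [MeasurableSpace Ω]

/-- This is the Poisson generating function at `z = exp (-c)`. It covers `c = ∞`, where it becomes
the void probability of `B`. -/
lemma IsHomogeneousPPP.lintegral_expNeg_count {μ : Measure Ω} {lam : ℝ} {X : ℕ → Ω → Plane}
    (hX : IsHomogeneousPPP μ lam X) (hlam : 0 ≤ lam) {B : Set Plane} (hB : MeasurableSet B)
    (hB' : volume B ≠ ∞) (c : ℝ≥0∞) :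
    ∫⁻ ω, expNeg (c * (pointCount X B ω : ℝ≥0∞)) ∂μ
      = expNeg ((1 - expNeg c) * (ENNReal.ofReal lam * volume B)) := by
  rw [(hX.hasLaw_count B hB hB').lintegral_comp (f := fun k : ℕ∞ => expNeg (c * (k : ℝ≥0∞)))
    (by fun_prop), lintegral_map (by fun_prop) (by fun_prop)]
  simp only [ENat.toENNReal_coe, expNeg_mul_nat]
  rw [lintegral_pow_poissonMeasure _ (expNeg_le_one c)]
  congr 2
  rw [← ENNReal.ofReal, ENNReal.ofReal_mul hlam, Measure.real, ENNReal.ofReal_toReal hB']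

/-- The Laplace functional of a Poisson configuration at a simple function. -/
lemma IsHomogeneousPPP.laplace_simpleFunc {μ : Measure Ω} [IsProbabilityMeasure μ] {lam : ℝ}
    {X : ℕ → Ω → Plane}
    (hX : IsHomogeneousPPP μ lam X) (hlam : 0 ≤ lam) (g : SimpleFunc Plane ℝ≥0∞)
    (hg : volume (Function.support g) ≠ ∞) :
    ∫⁻ ω, expNeg (∑' i, g (X i ω)) ∂μ
      = expNeg (∫⁻ x, (1 - expNeg (g x)) ∂(ENNReal.ofReal lam • volume)) := by
  classical
  -- The value `0` is left out because its level set has infinite area; the level sets of the other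
  -- values lie in the support.
  set s := g.range.filter (· ≠ 0) with hs
  let e := s.equivFin.symm
  let c : Fin s.card → ℝ≥0∞ := fun k => (e k : ℝ≥0∞)
  let B : Fin s.card → Set Plane := fun k => g ⁻¹' {c k}
  have hc0 : ∀ k, c k ≠ 0 := fun k => (Finset.mem_filter.1 (e k).2).2
  have hBm : ∀ k, MeasurableSet (B k) := fun k => g.measurableSet_preimage _
  have hBf : ∀ k, volume (B k) ≠ ∞ := fun k => by
    refine measure_ne_top_of_subset ?_ hg
    intro x hx
    simp only [B, Set.mem_preimage, Set.mem_singleton_iff] at hx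
    simp [hx, hc0]
  have hBd : Pairwise (fun k l => Disjoint (B k) (B l)) := by
    intro k l hkl
    refine Disjoint.preimage _ ?_
    simp only [Set.disjoint_singleton]
    intro h
    exact hkl (e.injective (Subtype.ext h))
  -- Used twice: with `F = id` inside the sum over the points, and with `F c = 1 - exp (-c)` in the
  -- intensity integral.
  have hdec : ∀ (F : ℝ≥0∞ → ℝ≥0∞) (_ : F 0 = 0) (x : Plane),
      F (g x) = ∑ k, (B k).indicator (fun _ => F (c k)) x := by
    intro F hF x
    by_cases hx : g x = 0
    · rw [hx, hF]
      symm
      refine Finset.sum_eq_zero fun k _ => ?_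
      rw [Set.indicator_of_notMem]
      simp only [B, Set.mem_preimage, Set.mem_singleton_iff, hx]
      exact (hc0 k).symm
    · have hmem : g x ∈ s := Finset.mem_filter.2 ⟨g.mem_range_self x, hx⟩
      have hk0 : c (e.symm ⟨g x, hmem⟩) = g x := by simp [c]
      rw [Finset.sum_eq_single (e.symm ⟨g x, hmem⟩)]
      · rw [Set.indicator_of_mem, hk0]
        simp [B, hk0]
      · intro k _ hk
        rw [Set.indicator_of_notMem]
        simp only [B, Set.mem_preimage, Set.mem_singleton_iff]
        intro h
        apply hk
        rw [Equiv.eq_symm_apply]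
        exact Subtype.ext h.symm
      · simp
  have h1 : ∀ ω, expNeg (∑' i, g (X i ω))
      = ∏ k, expNeg (c k * (pointCount X (B k) ω : ℝ≥0∞)) := by
    intro ω
    rw [← expNeg_sum]
    congr 1
    have hg' : ∀ x, g x = ∑ k, (B k).indicator (fun _ => c k) x := hdec id rfl
    simp_rw [← tsum_indicator_const_eq, hg']
    exact Summable.tsum_finsetSum (fun _ _ => ENNReal.summable)
  simp_rw [h1]
  have hcm : ∀ k, Measurable fun ω => c k * (pointCount X (B k) ω : ℝ≥0∞) := fun k => by
    simp_rw [← tsum_indicator_const_eq]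
    exact Measurable.tsum fun i =>
      (measurable_const.indicator (hBm k)).comp (hX.measurable i)
  have hind := (hX.iIndepFun_count _ B hBm hBf hBd).comp
    (fun k (n : ℕ∞) => expNeg (c k * (n : ℝ≥0∞))) (fun k => by fun_prop)
  refine (lintegral_prod_eq_prod_lintegral_of_indepFun Finset.univ _ hind
    (fun k => measurable_expNeg.comp (hcm k))).trans ?_
  simp only [Function.comp_apply]
  simp_rw [hX.lintegral_expNeg_count hlam (hBm _) (hBf _)]
  rw [← expNeg_sum]
  congr 1
  simp_rw [hdec (fun c => 1 - expNeg c) (by simp)]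
  rw [lintegral_finsetSum _ (fun k _ => measurable_const.indicator (hBm k))]
  refine Finset.sum_congr rfl fun k _ => ?_
  rw [lintegral_indicator_const (hBm k), Measure.smul_apply, smul_eq_mul]

/-- Monotone convergence for the counting measure. -/
lemma tendsto_tsum_of_monotone {f : ℕ → ℕ → ℝ≥0∞} {F : ℕ → ℝ≥0∞}
    (hf : ∀ i, Monotone fun n => f n i) (hF : ∀ i, Tendsto (fun n => f n i) atTop (𝓝 (F i))) :
    Tendsto (fun n => ∑' i, f n i) atTop (𝓝 (∑' i, F i)) := by
  simp_rw [← lintegral_count]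
  exact lintegral_tendsto_of_tendsto_of_monotone (fun n => by fun_prop)
    (ae_of_all _ hf) (ae_of_all _ hF)

lemma tendsto_lintegral_expNeg {Ω : Type*} [MeasurableSpace Ω] {μ : Measure Ω}
    [IsFiniteMeasure μ] {f : ℕ → Ω → ℝ≥0∞}
    {F : Ω → ℝ≥0∞} (hf : ∀ n, Measurable (f n))
    (hF : ∀ᵐ ω ∂μ, Tendsto (fun n => f n ω) atTop (𝓝 (F ω))) :
    Tendsto (fun n => ∫⁻ ω, expNeg (f n ω) ∂μ) atTop (𝓝 (∫⁻ ω, expNeg (F ω) ∂μ)) := by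
  refine tendsto_lintegral_of_dominated_convergence (fun _ => 1)
    (fun n => measurable_expNeg.comp (hf n)) (fun n => ae_of_all _ fun ω => expNeg_le_one _)
    (by simp) ?_
  filter_upwards [hF] with ω hω
  exact (continuous_expNeg.tendsto _).comp hω

lemma tendsto_lintegral_one_sub_expNeg {E : Type*} [MeasurableSpace E] {m : Measure E}
    {f : ℕ → E → ℝ≥0∞} {F : E → ℝ≥0∞} (hf : ∀ n, Measurable (f n))
    (hmono : ∀ x, Monotone fun n => f n x)
    (hF : ∀ᵐ x ∂m, Tendsto (fun n => f n x) atTop (𝓝 (F x))) :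
    Tendsto (fun n => ∫⁻ x, (1 - expNeg (f n x)) ∂m) atTop (𝓝 (∫⁻ x, (1 - expNeg (F x)) ∂m)) := by
  refine lintegral_tendsto_of_tendsto_of_monotone
    (fun n => (measurable_const.sub (measurable_expNeg.comp (hf n))).aemeasurable)
    (ae_of_all _ fun x n k h => tsub_le_tsub_left (expNeg_antitone (hmono x h)) _) ?_
  filter_upwards [hF] with x hx
  exact ENNReal.Tendsto.sub tendsto_const_nhds ((continuous_expNeg.tendsto _).comp hx) (by simp)

/-- The Laplace functional of a Poisson configuration. -/
lemma IsHomogeneousPPP.laplace {μ : Measure Ω} [IsProbabilityMeasure μ] {lam : ℝ}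
    {X : ℕ → Ω → Plane} (hX : IsHomogeneousPPP μ lam X) (hlam : 0 ≤ lam) {g : Plane → ℝ≥0∞}
    (hg : Measurable g) :
    ∫⁻ ω, expNeg (∑' i, g (X i ω)) ∂μ
      = expNeg (∫⁻ x, (1 - expNeg (g x)) ∂(ENNReal.ofReal lam • volume)) := by
  -- Truncating to growing balls keeps the approximation increasing and makes every support of
  -- finite area.
  let G : ℕ → SimpleFunc Plane ℝ≥0∞ := fun n =>
    (SimpleFunc.eapprox g n).restrict (Metric.closedBall 0 n)
  have hG : ∀ n x, G n x = (Metric.closedBall (0 : Plane) n).indicator (SimpleFunc.eapprox g n) x :=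
    fun n x => by simp only [G, SimpleFunc.restrict_apply _ Metric.isClosed_closedBall.measurableSet]
  have hGmono : ∀ x, Monotone fun n => G n x := by
    intro x n k hnk
    simp only [hG]
    refine (Set.indicator_le_indicator_of_subset
      (Metric.closedBall_subset_closedBall (Nat.cast_le.2 hnk)) (fun _ => zero_le) x).trans ?_
    exact Set.indicator_le_indicator (SimpleFunc.monotone_eapprox g hnk x)
  have hGlim : ∀ x, Tendsto (fun n => G n x) atTop (𝓝 (g x)) := by
    intro x
    refine (SimpleFunc.tendsto_eapprox hg x).congr' ?_
    obtain ⟨k, hk⟩ := exists_nat_ge (dist x 0)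
    filter_upwards [eventually_ge_atTop k] with n hn
    rw [hG, Set.indicator_of_mem]
    exact hk.trans (by exact_mod_cast hn)
  have hGfin : ∀ n, volume (Function.support (G n)) ≠ ∞ := fun n => by
    refine measure_ne_top_of_subset ?_ (measure_closedBall_lt_top (x := (0 : Plane)) (r := n)).ne
    intro x hx
    by_contra h
    exact hx (by rw [hG, Set.indicator_of_notMem h])
  have h1 := tendsto_lintegral_expNeg (μ := μ) (f := fun n ω => ∑' i, G n (X i ω))
    (F := fun ω => ∑' i, g (X i ω))
    (fun n => Measurable.tsum fun i => (G n).measurable.comp (hX.measurable i))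
    (ae_of_all _ fun ω => tendsto_tsum_of_monotone (fun i => hGmono _) (fun i => hGlim _))
  have h2 := (continuous_expNeg.tendsto _).comp
    (tendsto_lintegral_one_sub_expNeg (m := ENNReal.ofReal lam • volume) (fun n => (G n).measurable)
      hGmono (ae_of_all _ hGlim))
  refine tendsto_nhds_unique h1 (h2.congr fun n => ?_)
  exact (hX.laplace_simpleFunc hlam (G n) (hGfin n)).symm

end

/-! ### Polar coordinates, the contact law and the Rayleigh law. -/

lemma lintegral_complex_norm {F : ℝ → ℝ≥0∞} (hF : Measurable F) :
    ∫⁻ z : ℂ, F ‖z‖ = ∫⁻ r in Set.Ici (0 : ℝ), ENNReal.ofReal (2 * Real.pi * r) * F r := by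
  rw [setLIntegral_congr Ioi_ae_eq_Ici.symm, ← Complex.lintegral_comp_polarCoord_symm,
    polarCoord_target]
  have h1 : ∫⁻ p in Set.Ioi (0 : ℝ) ×ˢ Set.Ioo (-Real.pi) Real.pi,
        ENNReal.ofReal p.1 • F ‖Complex.polarCoord.symm p‖
      = ∫⁻ p in Set.Ioi (0 : ℝ) ×ˢ Set.Ioo (-Real.pi) Real.pi,
        (ENNReal.ofReal p.1 * F p.1) * (fun _ => 1) p.2 := by
    refine setLIntegral_congr_fun (measurableSet_Ioi.prod measurableSet_Ioo) fun p hp => ?_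
    simp only [Complex.norm_polarCoord_symm, abs_of_pos (Set.mem_Ioi.1 hp.1), smul_eq_mul, mul_one]
  rw [h1, Measure.volume_eq_prod, ← Measure.prod_restrict,
    lintegral_prod_mul (f := fun r => ENNReal.ofReal r * F r) (g := fun _ : ℝ => 1) (by fun_prop)
      (by fun_prop),
    setLIntegral_const, Real.volume_Ioo, one_mul, mul_comm, ← lintegral_const_mul _ (by fun_prop)]
  refine setLIntegral_congr_fun measurableSet_Ioi fun r hr => ?_
  rw [← mul_assoc, ← ENNReal.ofReal_mul (by linarith [Real.pi_pos])]
  congr 2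
  ring

lemma lintegral_plane_dist (u : Plane) {F : ℝ → ℝ≥0∞} (hF : Measurable F) :
    ∫⁻ x : Plane, F (dist x u)
      = ∫⁻ r in Set.Ici (0 : ℝ), ENNReal.ofReal (2 * Real.pi * r) * F r := by
  rw [← lintegral_complex_norm hF]
  simp_rw [dist_eq_norm]
  rw [lintegral_sub_right_eq_self (fun x : Plane => F ‖x‖) u]
  rw [← (Complex.orthonormalBasisOneI.measurePreserving_repr).lintegral_comp (by fun_prop)]
  simp

lemma lintegral_contactLaw (lam : ℝ) {F : ℝ → ℝ≥0∞} (hF : Measurable F) :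
    ∫⁻ x, F x ∂(contactLaw lam) = ∫⁻ x in Set.Ici (0 : ℝ),
      ENNReal.ofReal (2 * Real.pi * lam * x * Real.exp (-Real.pi * lam * x ^ 2)) * F x := by
  rw [contactLaw, lintegral_withDensity_eq_lintegral_mul _ (by fun_prop) hF]
  rfl

lemma contactLaw_Ici {lam : ℝ} (hlam : 0 < lam) {a : ℝ} (ha : 0 ≤ a) :
    contactLaw lam (Set.Ici a) = ENNReal.ofReal (Real.exp (-Real.pi * lam * a ^ 2)) := by
  rw [contactLaw, withDensity_apply _ measurableSet_Ici, Measure.restrict_restrict measurableSet_Ici,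
    Set.inter_eq_left.2 (Set.Ici_subset_Ici.2 ha), setLIntegral_congr Ioi_ae_eq_Ici.symm]
  have hpos : 0 < Real.pi * lam := mul_pos Real.pi_pos hlam
  have hd : ∀ x ∈ Set.Ici a, HasDerivAt (fun x => -Real.exp (-Real.pi * lam * x ^ 2))
      (2 * Real.pi * lam * x * Real.exp (-Real.pi * lam * x ^ 2)) x := by
    intro x _
    have h1 : HasDerivAt (fun x : ℝ => -Real.pi * lam * x ^ 2) (-Real.pi * lam * (2 * x)) x := by
      simpa using (hasDerivAt_pow 2 x).const_mul (-Real.pi * lam)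
    exact h1.exp.neg.congr_deriv (by ring)
  have hnn : ∀ x ∈ Set.Ioi a, 0 ≤ 2 * Real.pi * lam * x * Real.exp (-Real.pi * lam * x ^ 2) := by
    intro x hx
    have : 0 ≤ x := ha.trans (le_of_lt hx)
    have := Real.pi_pos
    positivity
  have hlim : Tendsto (fun x => -Real.exp (-Real.pi * lam * x ^ 2)) atTop (𝓝 0) := by
    rw [← neg_zero]
    refine Tendsto.neg (Real.tendsto_exp_atBot.comp ?_)
    simp_rw [neg_mul]
    exact tendsto_neg_atTop_atBot.comp ((tendsto_pow_atTop two_ne_zero).const_mul_atTop hpos)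
  rw [← ofReal_integral_eq_lintegral_ofReal (integrableOn_Ioi_deriv_of_nonneg' hd hnn hlim)
    ((ae_restrict_iff' measurableSet_Ioi).2 (ae_of_all _ hnn)),
    integral_Ioi_of_hasDerivAt_of_nonneg' hd hnn hlim]
  simp

lemma contactLaw_Iio_zero (lam : ℝ) : contactLaw lam (Set.Iio 0) = 0 := by
  rw [contactLaw, withDensity_apply _ measurableSet_Iio, Measure.restrict_restrict measurableSet_Iio,
    Set.Iio_inter_Ici, Set.Ico_self]
  simp

lemma isProbabilityMeasure_contactLaw {lam : ℝ} (hlam : 0 < lam) :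
    IsProbabilityMeasure (contactLaw lam) := by
  refine ⟨?_⟩
  rw [← Set.Iio_union_Ici (a := (0 : ℝ)), measure_union (by simp) measurableSet_Ici,
    contactLaw_Iio_zero,
    contactLaw_Ici hlam le_rfl]
  simp

lemma ae_contactLaw_nonneg (lam : ℝ) : ∀ᵐ r ∂(contactLaw lam), 0 ≤ r := by
  rw [ae_iff]
  simpa [Set.Iio_def] using contactLaw_Iio_zero lam

lemma contactLaw_absolutelyContinuous (lam : ℝ) : contactLaw lam ≪ volume :=
  (withDensity_absolutelyContinuous _ _).trans Measure.absolutelyContinuous_restrict 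

/-- The integrand times the contact density for `lam` is `1 / (1 + δ)` times the contact density for
`lam * (1 + δ)`, which has mass one. It serves both the fading, where `lam = π⁻¹`, and the one-slope
average over `r₀`. -/
lemma lintegral_exp_contactLaw {lam : ℝ} (hlam : 0 < lam) {δ : ℝ} (hδ : 0 ≤ δ) :
    ∫⁻ x, ENNReal.ofReal (Real.exp (-(Real.pi * lam * δ * x ^ 2))) ∂(contactLaw lam)
      = ENNReal.ofReal (1 / (1 + δ)) := by
  have hpos : 0 < 1 + δ := by positivity
  have h1 := (isProbabilityMeasure_contactLaw (mul_pos hlam hpos)).measure_univ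
  rw [contactLaw, withDensity_apply _ MeasurableSet.univ, Measure.restrict_univ] at h1
  rw [lintegral_contactLaw _ (by fun_prop), ← mul_one (ENNReal.ofReal (1 / (1 + δ))), ← h1,
    ← lintegral_const_mul _ (by fun_prop)]
  refine setLIntegral_congr_fun measurableSet_Ici fun x hx => ?_
  have hx' : (0 : ℝ) ≤ x := hx
  have := Real.pi_pos
  rw [← ENNReal.ofReal_mul (by positivity), ← ENNReal.ofReal_mul (by positivity)]
  congr 1
  rw [mul_assoc, ← Real.exp_add]
  have : -Real.pi * lam * x ^ 2 + -(Real.pi * lam * δ * x ^ 2)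
    = -Real.pi * (lam * (1 + δ)) * x ^ 2 := by ring
  rw [this]
  field_simp

/-- The modulus of a standard complex normal variable is Rayleigh distributed. -/
lemma map_norm_complexNormal : complexNormal.map (‖·‖) = contactLaw Real.pi⁻¹ := by
  have h1 : complexNormal = (volume : Measure ℂ).withDensity
      (fun z => ENNReal.ofReal (Real.pi⁻¹ * Real.exp (-‖z‖ ^ 2))) := by
    have hg : gaussianReal 0 (1 / 2) = volume.withDensity (gaussianPDF 0 (1 / 2)) :=
      gaussianReal_of_var_ne_zero 0 (by norm_num)
    refine Measure.ext_of_lintegral _ fun f hf => ?_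
    rw [complexNormal, lintegral_map hf (by fun_prop), hg,
      prod_withDensity (by fun_prop) (by fun_prop),
      lintegral_withDensity_eq_lintegral_mul _ (by fun_prop) (by fun_prop),
      lintegral_withDensity_eq_lintegral_mul _ (by fun_prop) hf,
      ← (Complex.volume_preserving_equiv_real_prod.symm).lintegral_comp (by fun_prop),
      Measure.volume_eq_prod]
    refine lintegral_congr fun p => ?_
    have hp : Complex.measurableEquivRealProd.symm p = (p.1 : ℂ) + (p.2 : ℂ) * Complex.I := by
      apply Complex.ext <;> simp [Complex.measurableEquivRealProd]
    simp only [Pi.mul_apply, hp]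
    congr 1
    rw [gaussianPDF, gaussianPDF, ← ENNReal.ofReal_mul (gaussianPDFReal_nonneg _ _ _)]
    congr 1
    have h2 : ‖(p.1 : ℂ) + (p.2 : ℂ) * Complex.I‖ ^ 2 = p.1 ^ 2 + p.2 ^ 2 := by
      rw [Complex.sq_norm, Complex.normSq_add_mul_I]
    have h3 : (√(2 * Real.pi * ((1 / 2 : ℝ≥0) : ℝ)))⁻¹ * (√(2 * Real.pi * ((1 / 2 : ℝ≥0) : ℝ)))⁻¹
        = Real.pi⁻¹ := by
      rw [← mul_inv, Real.mul_self_sqrt (by positivity)]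
      congr 1
      push_cast
      ring
    rw [h2, gaussianPDFReal, gaussianPDFReal, mul_mul_mul_comm, h3, ← Real.exp_add]
    congr 2
    push_cast
    ring
  ext s hs
  rw [Measure.map_apply measurable_norm hs, h1, withDensity_apply _ (measurable_norm hs),
    ← lintegral_indicator (measurable_norm hs)]
  have h2 := lintegral_complex_norm
    (F := s.indicator fun r => ENNReal.ofReal (Real.pi⁻¹ * Real.exp (-r ^ 2)))
    ((by fun_prop : Measurable fun r => ENNReal.ofReal (Real.pi⁻¹ * Real.exp (-r ^ 2))).indicator hs)
  refine (Eq.trans ?_ h2).trans ?_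
  · rfl
  rw [← lintegral_indicator_one hs, lintegral_contactLaw _ (measurable_one.indicator hs)]
  refine setLIntegral_congr_fun measurableSet_Ici fun x hx => ?_
  have hx' : (0 : ℝ) ≤ x := hx
  by_cases hxs : x ∈ s
  · have := Real.pi_pos
    simp only [Set.indicator_of_mem hxs, Pi.one_apply, mul_one]
    rw [← ENNReal.ofReal_mul (by positivity)]
    congr 1
    field_simp
  · simp [hxs]

/-! ### The nearest distance and the points beyond it. -/

section

/-- The intensity of the distances to a fixed point from a Poisson configuration of density `lam`. -/
def radialIntensity (lam : ℝ) : Measure ℝ :=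
  (volume.restrict (Set.Ici 0)).withDensity (fun r => ENNReal.ofReal (2 * Real.pi * lam * r))

instance (lam : ℝ) : SFinite (radialIntensity lam) := by
  unfold radialIntensity
  infer_instance

lemma lintegral_radialIntensity {lam : ℝ} (hlam : 0 ≤ lam) (u : Plane) {F : ℝ → ℝ≥0∞}
    (hF : Measurable F) :
    ∫⁻ x : Plane, F (dist x u) ∂(ENNReal.ofReal lam • volume) = ∫⁻ r, F r ∂(radialIntensity lam) := by
  rw [lintegral_smul_measure, lintegral_plane_dist u hF, radialIntensity,
    lintegral_withDensity_eq_lintegral_mul _ (by fun_prop) hF, smul_eq_mul,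
    ← lintegral_const_mul _ (by fun_prop)]
  refine lintegral_congr fun r => ?_
  rw [Pi.mul_apply, ← mul_assoc, ← ENNReal.ofReal_mul hlam]
  congr 2
  ring

lemma radialIntensity_Iio {lam : ℝ} (hlam : 0 ≤ lam) {a : ℝ} (ha : 0 ≤ a) :
    radialIntensity lam (Set.Iio a) = ENNReal.ofReal (Real.pi * lam * a ^ 2) := by
  rw [← lintegral_indicator_one measurableSet_Iio,
    ← lintegral_radialIntensity hlam 0 (measurable_one.indicator measurableSet_Iio)]
  have : (fun x : Plane => (Set.Iio a).indicator (1 : ℝ → ℝ≥0∞) (dist x 0))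
      = (Metric.ball 0 a).indicator 1 := by
    ext x
    by_cases h : dist x 0 < a
    · rw [Set.indicator_of_mem (by exact h), Set.indicator_of_mem (by exact h)]; rfl
    · rw [Set.indicator_of_notMem (by exact h), Set.indicator_of_notMem (by exact h)]
  rw [this, lintegral_indicator_one Metric.isOpen_ball.measurableSet, Measure.smul_apply,
    EuclideanSpace.volume_ball_fin_two, smul_eq_mul, ← ENNReal.ofReal_pow ha]
  rw [← ENNReal.ofReal_mul (by positivity), ← ENNReal.ofReal_mul hlam]
  congr 1
  ring

variable {Ω : Type*}

/-- The distance from `u` to the nearest point of the configuration. -/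
def nearestDist (X : ℕ → Ω → Plane) (u : Plane) (ω : Ω) : ℝ := ⨅ i, dist (X i ω) u

lemma le_nearestDist_iff {X : ℕ → Ω → Plane} {u : Plane} {ω : Ω} {a : ℝ} :
    a ≤ nearestDist X u ω ↔ ∀ i, a ≤ dist (X i ω) u :=
  le_ciInf_iff ⟨0, by rintro _ ⟨i, rfl⟩; exact dist_nonneg⟩

lemma nearestDist_nonneg (X : ℕ → Ω → Plane) (u : Plane) (ω : Ω) : 0 ≤ nearestDist X u ω :=
  le_nearestDist_iff.2 fun _ => dist_nonneg

lemma expNeg_tsum_indicator_top (X : ℕ → Ω → Plane) (u : Plane) (c : ℝ) (ω : Ω) :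
    expNeg (∑' i, (Set.Iio c).indicator (fun _ => ∞) (dist (X i ω) u))
      = {ω | c ≤ nearestDist X u ω}.indicator 1 ω := by
  by_cases h : c ≤ nearestDist X u ω
  · rw [Set.indicator_of_mem (by exact h), ENNReal.tsum_eq_zero.2, expNeg_zero, Pi.one_apply]
    intro i
    exact Set.indicator_of_notMem (s := Set.Iio c) (not_lt.2 (le_nearestDist_iff.1 h i)) _
  · rw [Set.indicator_of_notMem (by exact h)]
    rw [le_nearestDist_iff] at h
    push Not at h
    obtain ⟨i, hi⟩ := h
    rw [ENNReal.tsum_eq_top_of_eq_top ⟨i, Set.indicator_of_mem (by exact hi) _⟩, expNeg_top]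

variable [MeasurableSpace Ω] {μ : Measure Ω} {lam : ℝ} {X : ℕ → Ω → Plane}

lemma IsHomogeneousPPP.measurable_dist (hX : IsHomogeneousPPP μ lam X) (u : Plane) (i : ℕ) :
    Measurable fun ω => dist (X i ω) u :=
  (hX.measurable i).dist measurable_const

lemma IsHomogeneousPPP.measurable_nearestDist (hX : IsHomogeneousPPP μ lam X) (u : Plane) :
    Measurable (nearestDist X u) :=
  Measurable.iInf fun i => hX.measurable_dist u i

lemma IsHomogeneousPPP.laplace_dist [IsProbabilityMeasure μ]
    (hX : IsHomogeneousPPP μ lam X) (hlam : 0 ≤ lam) (u : Plane) {g : ℝ → ℝ≥0∞}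
    (hg : Measurable g) :
    ∫⁻ ω, expNeg (∑' i, g (dist (X i ω) u)) ∂μ
      = expNeg (∫⁻ r, (1 - expNeg (g r)) ∂(radialIntensity lam)) := by
  rw [hX.laplace hlam (g := fun x => g (dist x u)) (by fun_prop),
    lintegral_radialIntensity hlam u (F := fun r => 1 - expNeg (g r)) (by fun_prop)]

/-- Apply the Laplace functional to the test function that is `∞` below `c` and `f` from `b` on.
Since `c ≤ b` the two supports are disjoint, so the exponent splits into the void part `πλc²` and
the part of `f`. -/
lemma IsHomogeneousPPP.lintegral_le_nearestDist [IsProbabilityMeasure μ]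
    (hX : IsHomogeneousPPP μ lam X) (hlam : 0 < lam) (u : Plane) {f : ℝ → ℝ≥0∞}
    (hf : Measurable f) {c b : ℝ} (hc : 0 ≤ c) (hcb : c ≤ b) :
    ∫⁻ ω in {ω | c ≤ nearestDist X u ω}, expNeg (∑' i, (Set.Ici b).indicator f (dist (X i ω) u)) ∂μ
      = contactLaw lam (Set.Ici c)
        * expNeg (∫⁻ r, (1 - expNeg ((Set.Ici b).indicator f r)) ∂(radialIntensity lam)) := by
  have hfb := hf.indicator (measurableSet_Ici (a := b))
  have hct : Measurable ((Set.Iio c).indicator (fun _ : ℝ => (∞ : ℝ≥0∞))) :=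
    measurable_const.indicator measurableSet_Iio
  rw [← lintegral_indicator (measurableSet_le measurable_const (hX.measurable_nearestDist u))]
  have h1 := hX.laplace_dist hlam.le u (hct.add hfb)
  simp only [Pi.add_apply, ENNReal.summable.tsum_add ENNReal.summable, expNeg_add,
    expNeg_tsum_indicator_top] at h1
  have h2 : ∀ r, 1 - expNeg ((Set.Iio c).indicator (fun _ => ∞) r) * expNeg ((Set.Ici b).indicator f r)
      = (Set.Iio c).indicator 1 r + (1 - expNeg ((Set.Ici b).indicator f r)) := by
    intro r
    by_cases h : r < c
    · have hb : r ∉ Set.Ici b := fun hb => absurd (hcb.trans hb) (not_le.2 h)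
      have hc : r ∈ Set.Iio c := h
      simp only [Set.indicator_of_mem hc, Set.indicator_of_notMem hb, expNeg_top, zero_mul,
        expNeg_zero, Pi.one_apply, tsub_zero, tsub_self, add_zero]
    · have hc : r ∉ Set.Iio c := h
      simp only [Set.indicator_of_notMem hc, expNeg_zero, one_mul, zero_add]
  simp only [h2] at h1
  rw [lintegral_add_left (measurable_one.indicator measurableSet_Iio),
    lintegral_indicator_one measurableSet_Iio, radialIntensity_Iio hlam.le hc, expNeg_add,
    expNeg_ofReal (mul_nonneg (mul_nonneg Real.pi_pos.le hlam.le) (sq_nonneg c))] at h1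
  rw [contactLaw_Ici hlam hc, neg_mul, neg_mul, ← h1]
  refine lintegral_congr fun ω => ?_
  by_cases h : ω ∈ {ω | c ≤ nearestDist X u ω}
  · simp only [Set.indicator_of_mem h, Pi.one_apply, one_mul]
  · simp only [Set.indicator_of_notMem h, zero_mul]

lemma contactLaw_Ici_of_nonpos (hlam : 0 < lam) {a : ℝ} (ha : a ≤ 0) :
    contactLaw lam (Set.Ici a) = 1 := by
  have := isProbabilityMeasure_contactLaw hlam
  refine le_antisymm prob_le_one ?_
  calc (1 : ℝ≥0∞) = contactLaw lam (Set.Ici 0) := by simp [contactLaw_Ici hlam le_rfl]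
    _ ≤ _ := measure_mono (Set.Ici_subset_Ici.2 ha)

/-- The nearest point has the contact distribution. -/
lemma IsHomogeneousPPP.hasLaw_nearestDist [IsProbabilityMeasure μ]
    (hX : IsHomogeneousPPP μ lam X) (hlam : 0 < lam) (u : Plane) :
    HasLaw (nearestDist X u) (contactLaw lam) μ := by
  have hm := hX.measurable_nearestDist u
  refine ⟨hm.aemeasurable, ?_⟩
  have : IsProbabilityMeasure (μ.map (nearestDist X u)) :=
    Measure.isProbabilityMeasure_map hm.aemeasurable
  refine Measure.ext_of_Ici _ _ fun a => ?_
  rw [Measure.map_apply hm measurableSet_Ici]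
  rcases le_total a 0 with ha | ha
  · rw [contactLaw_Ici_of_nonpos hlam ha]
    convert! measure_univ (μ := μ)
    ext ω
    simpa using ha.trans (nearestDist_nonneg X u ω)
  -- With `f = 0` only the void probability of the disc of radius `a` remains.
  · have := hX.lintegral_le_nearestDist hlam u (f := 0) measurable_zero ha le_rfl
    simp only [Set.indicator_zero', Pi.zero_apply, tsum_zero, expNeg_zero, lintegral_const,
      Measure.restrict_apply_univ, one_mul, tsub_self, zero_mul, mul_one] at this
    exact this

/-- The difference of the previous identity at `c = a` and at `c = b`, with the same `f` beyond `b`;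
the common term cancels because it is finite. -/
lemma IsHomogeneousPPP.lintegral_nearestDist_mem_Ico [IsProbabilityMeasure μ]
    (hX : IsHomogeneousPPP μ lam X) (hlam : 0 < lam) (u : Plane) {f : ℝ → ℝ≥0∞}
    (hf : Measurable f) {a b : ℝ} (ha : 0 ≤ a) (hab : a ≤ b) :
    ∫⁻ ω in nearestDist X u ⁻¹' Set.Ico a b,
        expNeg (∑' i, (Set.Ici b).indicator f (dist (X i ω) u)) ∂μ
      = contactLaw lam (Set.Ico a b)
        * expNeg (∫⁻ r, (1 - expNeg ((Set.Ici b).indicator f r)) ∂(radialIntensity lam)) := by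
  have := isProbabilityMeasure_contactLaw hlam
  have h1 := hX.lintegral_le_nearestDist hlam u hf ha hab
  have h2 := hX.lintegral_le_nearestDist hlam u hf (ha.trans hab) le_rfl
  have hm := hX.measurable_nearestDist u
  rw [← Set.Ico_union_Ici_eq_Ici hab, measure_union _ measurableSet_Ici, add_mul, ← h2] at h1
  · have h3 : {ω | a ≤ nearestDist X u ω}
        = nearestDist X u ⁻¹' Set.Ico a b ∪ {ω | b ≤ nearestDist X u ω} := by
      ext ω
      constructor
      · intro h
        rcases lt_or_ge (nearestDist X u ω) b with h' | h'
        · exact .inl ⟨h, h'⟩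
        · exact .inr h'
      · rintro (h | h)
        · exact h.1
        · exact hab.trans h
    rw [h3, lintegral_union (measurableSet_le measurable_const hm)] at h1
    · refine (ENNReal.add_left_inj ?_).1 h1
      rw [h2]
      exact ENNReal.mul_ne_top (measure_ne_top _ _) (expNeg_ne_top _)
    · exact Set.disjoint_left.2 fun ω h h' => absurd h.2 (not_lt.2 h')
  · exact Set.disjoint_left.2 fun x h h' => absurd h.2 (not_lt.2 h')

/-- The left end of the dyadic interval of level `n` that contains `r`. -/
def dyadicFloor (n : ℕ) (r : ℝ) : ℝ := ⌊2 ^ n * r⌋₊ / 2 ^ n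

/-- The right end of the dyadic interval of level `n` that contains `r`. -/
def dyadicCeil (n : ℕ) (r : ℝ) : ℝ := (⌊2 ^ n * r⌋₊ + 1) / 2 ^ n

@[fun_prop]
lemma measurable_dyadicFloor (n : ℕ) : Measurable (dyadicFloor n) := by
  unfold dyadicFloor; fun_prop

@[fun_prop]
lemma measurable_dyadicCeil (n : ℕ) : Measurable (dyadicCeil n) := by
  unfold dyadicCeil; fun_prop

lemma dyadicFloor_nonneg (n : ℕ) (r : ℝ) : 0 ≤ dyadicFloor n r := by
  unfold dyadicFloor; positivity

lemma dyadicFloor_le (n : ℕ) {r : ℝ} (hr : 0 ≤ r) : dyadicFloor n r ≤ r := by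
  unfold dyadicFloor
  rw [div_le_iff₀ (by positivity), mul_comm r]
  exact Nat.floor_le (by positivity)

lemma lt_dyadicCeil (n : ℕ) (r : ℝ) : r < dyadicCeil n r := by
  unfold dyadicCeil
  rw [lt_div_iff₀ (by positivity), mul_comm r]
  exact Nat.lt_floor_add_one _

lemma dyadicCeil_eq (n : ℕ) (r : ℝ) : dyadicCeil n r = dyadicFloor n r + (1 / 2) ^ n := by
  unfold dyadicCeil dyadicFloor
  rw [add_div, one_div_pow]

lemma floor_two_mul_mem {x : ℝ} (hx : 0 ≤ x) :
    2 * ⌊x⌋₊ ≤ ⌊2 * x⌋₊ ∧ ⌊2 * x⌋₊ + 1 ≤ 2 * ⌊x⌋₊ + 2 := by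
  have h1 := Nat.floor_le hx
  have h2 := Nat.lt_floor_add_one x
  constructor
  · refine Nat.le_floor ?_
    push_cast
    linarith
  · rw [Nat.add_le_add_iff_right (n := 1) (k := 2 * ⌊x⌋₊ + 1)] 
    refine Nat.lt_succ_iff.1 ((Nat.floor_lt (by positivity)).2 ?_)
    push_cast
    linarith

lemma dyadicFloor_mono {r : ℝ} (hr : 0 ≤ r) : Monotone fun n => dyadicFloor n r := by
  refine monotone_nat_of_le_succ fun n => ?_
  unfold dyadicFloor
  have h := (floor_two_mul_mem (x := 2 ^ n * r) (by positivity)).1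
  rw [div_le_div_iff₀ (by positivity) (by positivity), pow_succ' (2 : ℝ) n, mul_assoc 2 (2 ^ n) r]
  have h' : (2 : ℝ) * ⌊2 ^ n * r⌋₊ ≤ ⌊2 * (2 ^ n * r)⌋₊ := by exact_mod_cast h
  nlinarith [pow_pos (two_pos : (0 : ℝ) < 2) n]

lemma dyadicCeil_anti {r : ℝ} (hr : 0 ≤ r) : Antitone fun n => dyadicCeil n r := by
  refine antitone_nat_of_succ_le fun n => ?_
  unfold dyadicCeil
  have h := (floor_two_mul_mem (x := 2 ^ n * r) (by positivity)).2
  rw [div_le_div_iff₀ (by positivity) (by positivity), pow_succ' (2 : ℝ) n, mul_assoc 2 (2 ^ n) r]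
  have h' : (⌊2 * (2 ^ n * r)⌋₊ : ℝ) + 1 ≤ 2 * ⌊2 ^ n * r⌋₊ + 2 := by exact_mod_cast h
  nlinarith [pow_pos (two_pos : (0 : ℝ) < 2) n]

lemma tendsto_dyadicFloor {r : ℝ} (hr : 0 ≤ r) :
    Tendsto (fun n => dyadicFloor n r) atTop (𝓝 r) := by
  have h0 : Tendsto (fun n : ℕ => r - (1 / 2 : ℝ) ^ n) atTop (𝓝 r) := by
    simpa using tendsto_const_nhds.sub
      (tendsto_pow_atTop_nhds_zero_of_lt_one (r := (1 / 2 : ℝ)) (by norm_num) (by norm_num))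
  refine tendsto_of_tendsto_of_tendsto_of_le_of_le h0 tendsto_const_nhds (fun n => ?_)
    fun n => dyadicFloor_le n hr
  have := lt_dyadicCeil n r
  rw [dyadicCeil_eq] at this
  simp only
  linarith

lemma tendsto_dyadicCeil {r : ℝ} (hr : 0 ≤ r) :
    Tendsto (fun n => dyadicCeil n r) atTop (𝓝 r) := by
  simp_rw [dyadicCeil_eq]
  simpa using (tendsto_dyadicFloor hr).add
    (tendsto_pow_atTop_nhds_zero_of_lt_one (r := (1 / 2 : ℝ)) (by norm_num) (by norm_num))

lemma floor_eq_of_mem_Ico {n k : ℕ} {r : ℝ} (hr : r ∈ Set.Ico ((k : ℝ) / 2 ^ n) ((k + 1) / 2 ^ n)) :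
    ⌊2 ^ n * r⌋₊ = k := by
  have h1 := hr.1
  have h2 := hr.2
  rw [div_le_iff₀ (by positivity), mul_comm r] at h1
  rw [lt_div_iff₀ (by positivity), mul_comm r] at h2
  exact (Nat.floor_eq_iff (h1.trans' (by positivity))).2 ⟨h1, h2⟩

lemma lintegral_eq_tsum_dyadic {E : Type*} [MeasurableSpace E] {ν : Measure E} {T : E → ℝ}
    (hT : Measurable T) (hT0 : ∀ᵐ x ∂ν, 0 ≤ T x) (n : ℕ) (F : E → ℝ≥0∞) :
    ∫⁻ x, F x ∂ν = ∑' k : ℕ, ∫⁻ x in T ⁻¹' Set.Ico ((k : ℝ) / 2 ^ n) ((k + 1) / 2 ^ n), F x ∂ν := by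
  rw [← lintegral_iUnion (fun k => hT measurableSet_Ico), ← setLIntegral_univ]
  · refine setLIntegral_congr ?_
    filter_upwards [hT0] with x hx
    refine propext ⟨fun _ => ?_, fun _ => trivial⟩
    refine Set.mem_iUnion.2 ⟨⌊2 ^ n * T x⌋₊, dyadicFloor_le n hx, lt_dyadicCeil n (T x)⟩
  · intro k l hkl
    refine Set.disjoint_left.2 fun x h h' => hkl ?_
    rw [← floor_eq_of_mem_Ico h, ← floor_eq_of_mem_Ico h']

/-- On each dyadic interval the kernel is frozen at the left end and only points beyond the right
end are counted, so the independence on a fixed interval applies cell by cell. -/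
lemma IsHomogeneousPPP.lintegral_nearestDist_dyadic [IsProbabilityMeasure μ]
    (hX : IsHomogeneousPPP μ lam X) (hlam : 0 < lam) (u : Plane) {G : ℝ → ℝ → ℝ≥0∞}
    (hG : ∀ a, Measurable (G a)) (n : ℕ) :
    ∫⁻ ω, expNeg (∑' i, (Set.Ici (dyadicCeil n (nearestDist X u ω))).indicator
        (G (dyadicFloor n (nearestDist X u ω))) (dist (X i ω) u)) ∂μ
      = ∫⁻ r, expNeg (∫⁻ t, (1 - expNeg ((Set.Ici (dyadicCeil n r)).indicator
          (G (dyadicFloor n r)) t)) ∂(radialIntensity lam)) ∂(contactLaw lam) := by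
  have hm := hX.measurable_nearestDist u
  rw [lintegral_eq_tsum_dyadic hm (ae_of_all _ (nearestDist_nonneg X u)) n,
    lintegral_eq_tsum_dyadic measurable_id (ae_contactLaw_nonneg lam) n]
  refine tsum_congr fun k => ?_
  have h1 := hX.lintegral_nearestDist_mem_Ico hlam u (hG (k / 2 ^ n)) (a := k / 2 ^ n)
    (b := (k + 1) / 2 ^ n) (by positivity) (by gcongr; linarith)
  rw [Set.preimage_id, mul_comm, ← setLIntegral_const] at *
  refine (Eq.trans ?_ h1).trans ?_
  · refine setLIntegral_congr_fun (hm measurableSet_Ico) fun ω hω => ?_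
    simp only [dyadicCeil, dyadicFloor, floor_eq_of_mem_Ico hω]
  · refine setLIntegral_congr_fun measurableSet_Ico fun r hr => ?_
    simp only [dyadicCeil, dyadicFloor, floor_eq_of_mem_Ico hr]

/-- The dyadic approximation from below of the kernel `G r t` on `r < t`. -/
def dyadicKernel (G : ℝ → ℝ → ℝ≥0∞) (n : ℕ) (r t : ℝ) : ℝ≥0∞ :=
  (Set.Ici (dyadicCeil n r)).indicator (G (dyadicFloor n r)) t

lemma measurable_dyadicKernel {G : ℝ → ℝ → ℝ≥0∞} (hG : Measurable (Function.uncurry G)) (n : ℕ) :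
    Measurable (Function.uncurry (dyadicKernel G n)) := by
  have : Function.uncurry (dyadicKernel G n) = {p : ℝ × ℝ | dyadicCeil n p.1 ≤ p.2}.indicator
      (fun p => Function.uncurry G (dyadicFloor n p.1, p.2)) := by
    ext ⟨r, t⟩
    rfl
  rw [this]
  exact (hG.comp (by fun_prop)).indicator (measurableSet_le (by fun_prop) (by fun_prop))

/-- As `n` grows the right end decreases, which admits more points, and the left end increases,
which enlarges `G`. This monotonicity is what allows the limit inside the infinite sum over the
points. -/
lemma dyadicKernel_mono {G : ℝ → ℝ → ℝ≥0∞} (hmono : ∀ t, MonotoneOn (fun r => G r t) (Set.Ici 0))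
    {r : ℝ} (hr : 0 ≤ r) (t : ℝ) : Monotone fun n => dyadicKernel G n r t := by
  intro n k hnk
  refine (Set.indicator_le_indicator_of_subset (Set.Ici_subset_Ici.2 (dyadicCeil_anti hr hnk))
    (fun _ => zero_le) t).trans ?_
  exact Set.indicator_le_indicator (hmono t (dyadicFloor_nonneg n r) (dyadicFloor_nonneg k r)
    (dyadicFloor_mono hr hnk))

lemma tendsto_dyadicKernel {G : ℝ → ℝ → ℝ≥0∞} {r : ℝ} (hr : 0 ≤ r)
    (hc : ∀ t, ContinuousAt (fun r => G r t) r) (t : ℝ) :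
    Tendsto (fun n => dyadicKernel G n r t) atTop (𝓝 ((Set.Ioi r).indicator (G r) t)) := by
  rcases lt_or_ge r t with hrt | hrt
  · rw [Set.indicator_of_mem (s := Set.Ioi r) hrt]
    refine ((hc t).tendsto.comp (tendsto_dyadicFloor hr)).congr' ?_
    filter_upwards [(tendsto_dyadicCeil hr).eventually_le_const hrt] with n hn
    exact (Set.indicator_of_mem (s := Set.Ici (dyadicCeil n r)) hn _).symm
  -- The right end lies strictly above `r` at every level, so the nearest point itself never
  -- contributes.
  · rw [Set.indicator_of_notMem (s := Set.Ioi r) (not_lt.2 hrt)]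
    refine tendsto_const_nhds.congr fun n => ?_
    exact (Set.indicator_of_notMem (s := Set.Ici (dyadicCeil n r))
      (not_le.2 (hrt.trans_lt (lt_dyadicCeil n r))) _).symm

/-- The Laplace functional of the points beyond the nearest one. -/
lemma IsHomogeneousPPP.laplace_beyond_nearest [IsProbabilityMeasure μ]
    (hX : IsHomogeneousPPP μ lam X) (hlam : 0 < lam) (u : Plane) {G : ℝ → ℝ → ℝ≥0∞}
    (hG : Measurable (Function.uncurry G)) (hmono : ∀ t, MonotoneOn (fun r => G r t) (Set.Ici 0))
    (hcont : ∀ᵐ r, 0 ≤ r → ∀ t, ContinuousAt (fun r => G r t) r) :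
    ∫⁻ ω, expNeg (∑' i, (Set.Ioi (nearestDist X u ω)).indicator
        (G (nearestDist X u ω)) (dist (X i ω) u)) ∂μ
      = ∫⁻ r, expNeg (∫⁻ t, (1 - expNeg ((Set.Ioi r).indicator (G r) t))
          ∂(radialIntensity lam)) ∂(contactLaw lam) := by
  have := isProbabilityMeasure_contactLaw hlam
  have hlaw := hX.hasLaw_nearestDist hlam u
  have hcont' := (contactLaw_absolutelyContinuous lam).ae_le hcont
  have hgood : ∀ᵐ ω ∂μ, ∀ t, ContinuousAt (fun r => G r t) (nearestDist X u ω) := by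
    rw [← hlaw.map_eq] at hcont'
    filter_upwards [ae_of_ae_map hlaw.aemeasurable hcont'] with ω hω
    exact hω (nearestDist_nonneg X u ω)
  have h1 : Tendsto (fun n => ∫⁻ ω,
      expNeg (∑' i, dyadicKernel G n (nearestDist X u ω) (dist (X i ω) u)) ∂μ) atTop
      (𝓝 (∫⁻ ω, expNeg (∑' i, (Set.Ioi (nearestDist X u ω)).indicator
        (G (nearestDist X u ω)) (dist (X i ω) u)) ∂μ)) := by
    have hk : ∀ n i, Measurable fun ω =>
        dyadicKernel G n (nearestDist X u ω) (dist (X i ω) u) := fun n i =>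
      (measurable_dyadicKernel hG n).comp
        (f := fun ω => (nearestDist X u ω, dist (X i ω) u))
        ((hX.measurable_nearestDist u).prodMk (hX.measurable_dist u i))
    refine tendsto_lintegral_expNeg
      (f := fun n ω => ∑' i, dyadicKernel G n (nearestDist X u ω) (dist (X i ω) u))
      (fun n => Measurable.tsum (hk n)) ?_
    filter_upwards [hgood] with ω hω
    exact tendsto_tsum_of_monotone
      (fun i => dyadicKernel_mono hmono (nearestDist_nonneg X u ω) _)
      (fun i => tendsto_dyadicKernel (nearestDist_nonneg X u ω) hω _)
  have h2 : Tendsto (fun n => ∫⁻ r,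
      expNeg (∫⁻ t, (1 - expNeg (dyadicKernel G n r t)) ∂(radialIntensity lam)) ∂(contactLaw lam))
      atTop (𝓝 (∫⁻ r, expNeg (∫⁻ t, (1 - expNeg ((Set.Ioi r).indicator (G r) t))
          ∂(radialIntensity lam)) ∂(contactLaw lam))) := by
    refine tendsto_lintegral_expNeg
      (f := fun n r => ∫⁻ t, (1 - expNeg (dyadicKernel G n r t)) ∂(radialIntensity lam))
      (fun n => Measurable.lintegral_prod_right'
      (f := fun p : ℝ × ℝ => 1 - expNeg (Function.uncurry (dyadicKernel G n) p))
      (measurable_const.sub (measurable_expNeg.comp (measurable_dyadicKernel hG n)))) ?_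
    filter_upwards [hcont', ae_contactLaw_nonneg lam] with r hr hr0
    exact tendsto_lintegral_one_sub_expNeg
      (fun n => (measurable_dyadicKernel hG n).of_uncurry_left)
      (dyadicKernel_mono hmono hr0) (ae_of_all _ (tendsto_dyadicKernel hr0 (hr hr0)))
  refine tendsto_nhds_unique h1 (h2.congr fun n => ?_)
  have hGa : ∀ a, Measurable (G a) := fun a => hG.of_uncurry_left
  exact (hX.lintegral_nearestDist_dyadic hlam u hGa n).symm

end

/-! ### Existence and uniqueness of the nearest point. -/

section

/-- From `exp (-r) ≥ 1 - r` one gets `1 - (1 + r) exp (-r) ≤ 1 - (1 + r)(1 - r) = r²`. -/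
lemma poissonMeasure_two_le (r : ℝ≥0) :
    poissonMeasure r {k | 2 ≤ k} ≤ ENNReal.ofReal ((r : ℝ) ^ 2) := by
  have h1 : ({k | 2 ≤ k} : Set ℕ) = ({0, 1} : Set ℕ)ᶜ := by
    ext k
    simp only [Set.mem_ofPred_eq, Set.mem_compl_iff, Set.mem_insert_iff, Set.mem_singleton_iff]
    omega
  rw [h1, ← ofReal_measureReal, probReal_compl_eq_one_sub (Set.toFinite _).measurableSet]
  refine ENNReal.ofReal_le_ofReal ?_
  rw [Set.insert_eq, measureReal_union (by simp) (by simp), poissonMeasure_real_singleton,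
    poissonMeasure_real_singleton]
  have h2 := Real.one_sub_le_exp_neg (r : ℝ)
  have h3 : (0 : ℝ) ≤ r := r.2
  simp only [pow_zero, mul_one, Nat.factorial_zero, Nat.cast_one, div_one, pow_one,
    Nat.factorial_one]
  nlinarith

variable {Ω : Type*} [MeasurableSpace Ω] {μ : Measure Ω} {lam : ℝ} {X : ℕ → Ω → Plane}

lemma IsHomogeneousPPP.measure_two_le_count (hX : IsHomogeneousPPP μ lam X) (hlam : 0 ≤ lam)
    {B : Set Plane} (hB : MeasurableSet B) (hB' : volume B ≠ ∞) :
    μ {ω | 2 ≤ pointCount X B ω} ≤ ENNReal.ofReal ((lam * volume.real B) ^ 2) := by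
  rw [(hX.hasLaw_count B hB hB').measure_eq (p := fun k => 2 ≤ k) .of_discrete,
    Measure.map_apply .of_discrete .of_discrete]
  have : (fun k : ℕ => (k : ℕ∞)) ⁻¹' {x | 2 ≤ x} = {k | 2 ≤ k} := by
    ext k
    simp only [Set.mem_preimage, Set.mem_ofPred_eq]
    norm_cast
  rw [this]
  refine (poissonMeasure_two_le _).trans ?_
  rw [Real.coe_toNNReal _ (mul_nonneg hlam measureReal_nonneg)]

/-- The Poisson law lives on finite counts; integer radii suffice and keep the exceptional sets
countable. -/
lemma IsHomogeneousPPP.ae_finite_ball (hX : IsHomogeneousPPP μ lam X) (u : Plane) :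
    ∀ᵐ ω ∂μ, ∀ M : ℕ, {i | dist (X i ω) u < M}.Finite := by
  rw [ae_all_iff]
  intro M
  have h1 := hX.hasLaw_count (Metric.ball u M) Metric.isOpen_ball.measurableSet measure_ball_lt_top.ne
  have h2 : ∀ᵐ ω ∂μ, pointCount X (Metric.ball u M) ω ≠ ⊤ := by
    rw [h1.ae_iff (p := fun k => k ≠ ⊤) .of_discrete, ae_map_iff (by fun_prop) .of_discrete]
    exact ae_of_all _ fun k => ENat.natCast_ne_top k
  filter_upwards [h2] with ω hω
  exact Set.encard_ne_top_iff.1 hω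

lemma dist_preimage_Ico (u : Plane) {a b : ℝ} (ha : 0 ≤ a) (hab : a ≤ b) :
    volume.real ((fun x : Plane => dist x u) ⁻¹' Set.Ico a b) = Real.pi * (b ^ 2 - a ^ 2)
      ∧ volume ((fun x : Plane => dist x u) ⁻¹' Set.Ico a b) ≠ ∞ := by
  have h1 : (fun x : Plane => dist x u) ⁻¹' Set.Ico a b = Metric.ball u b \ Metric.ball u a := by
    ext x
    simp [and_comm]
  rw [h1]
  refine ⟨?_, measure_ne_top_of_subset Set.sdiff_subset measure_ball_lt_top.ne⟩
  rw [measureReal_sdiff (Metric.ball_subset_ball hab) Metric.isOpen_ball.measurableSet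
    measure_ball_lt_top.ne, Measure.real, Measure.real, EuclideanSpace.volume_ball_fin_two,
    EuclideanSpace.volume_ball_fin_two]
  simp only [ENNReal.toReal_mul, ENNReal.toReal_pow, ENNReal.toReal_ofReal ha,
    ENNReal.toReal_ofReal (ha.trans hab)]
  rw [ENNReal.toReal_ofReal Real.pi_pos.le]
  ring

lemma two_le_encard {s : Set ℕ} {i j : ℕ} (hij : i ≠ j) (hi : i ∈ s) (hj : j ∈ s) :
    2 ≤ s.encard := by
  rw [← Set.encard_pair hij]
  exact Set.encard_le_encard (Set.insert_subset hi (Set.singleton_subset_iff.2 hj))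

/-- Almost surely no two points of a Poisson configuration are equally far from `u`. -/
lemma IsHomogeneousPPP.ae_injective_dist (hX : IsHomogeneousPPP μ lam X) (hlam : 0 ≤ lam)
    (u : Plane) : ∀ᵐ ω ∂μ, Function.Injective fun i => dist (X i ω) u := by
  have key : ∀ M : ℕ, μ {ω | ∃ i j, i ≠ j ∧ dist (X i ω) u = dist (X j ω) u ∧ dist (X i ω) u < M}
      = 0 := by
    intro M
    set S := {ω | ∃ i j, i ≠ j ∧ dist (X i ω) u = dist (X j ω) u ∧ dist (X i ω) u < M}
    let B : ℕ → ℕ → Set Plane := fun n k =>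
      (fun x : Plane => dist x u) ⁻¹' Set.Ico ((k : ℝ) / 2 ^ n) ((k + 1) / 2 ^ n)
    -- Two equidistant points share one of `M * 2 ^ n` annuli of width `2 ^ (-n)`. Each annulus has
    -- area at most `2πM * 2 ^ (-n)`, so it holds two points with probability of order `4 ^ (-n)`,
    -- and the union bound is of order `2 ^ (-n)`.
    have h1 : ∀ n, μ S ≤ ENNReal.ofReal (M * (Real.pi * lam * 2 * M) ^ 2 * (1 / 2) ^ n) := by
      intro n
      have hsub : S ⊆ ⋃ k ∈ Finset.range (M * 2 ^ n), {ω | 2 ≤ pointCount X (B n k) ω} := by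
        rintro ω ⟨i, j, hij, hd, hM⟩
        have hmem : dist (X i ω) u ∈ Set.Ico ((⌊2 ^ n * dist (X i ω) u⌋₊ : ℝ) / 2 ^ n)
            ((⌊2 ^ n * dist (X i ω) u⌋₊ + 1) / 2 ^ n) :=
          ⟨dyadicFloor_le n dist_nonneg, lt_dyadicCeil n _⟩
        simp only [Set.mem_iUnion, Finset.mem_range]
        refine ⟨⌊2 ^ n * dist (X i ω) u⌋₊, ?_, two_le_encard hij hmem ?_⟩
        · rw [Nat.floor_lt (by positivity), mul_comm]
          push_cast
          gcongr
        · rw [Set.mem_ofPred_eq, Set.mem_preimage, ← hd]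
          exact hmem
      refine (measure_mono hsub).trans ((measure_biUnion_finset_le _ _).trans ?_)
      have h2 : ∀ k ∈ Finset.range (M * 2 ^ n), μ {ω | 2 ≤ pointCount X (B n k) ω}
          ≤ ENNReal.ofReal ((Real.pi * lam * 2 * M * (1 / 2) ^ n) ^ 2) := by
        intro k hk
        have hk' : ((k : ℝ) + 1) ≤ M * 2 ^ n := by
          exact_mod_cast Nat.succ_le_of_lt (Finset.mem_range.1 hk)
        have hv := dist_preimage_Ico u (a := (k : ℝ) / 2 ^ n) (b := (k + 1) / 2 ^ n) (by positivity)
          (by gcongr; linarith)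
        refine (hX.measure_two_le_count hlam
          ((measurable_id.dist measurable_const) measurableSet_Ico) hv.2).trans ?_
        refine ENNReal.ofReal_le_ofReal ?_
        refine pow_le_pow_left₀ (mul_nonneg hlam measureReal_nonneg) ?_ 2
        refine (le_of_eq (congrArg (lam * ·) hv.1)).trans ?_
        have hb : ((k : ℝ) + 1) / 2 ^ n ≤ M := by rwa [div_le_iff₀ (by positivity)]
        have ha : (k : ℝ) / 2 ^ n ≤ M := le_trans (by gcongr; linarith) hb
        have hba : ((k : ℝ) + 1) / 2 ^ n = k / 2 ^ n + (1 / 2) ^ n := by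
          rw [add_div, one_div_pow]
        have hfac : (((k : ℝ) + 1) / 2 ^ n) ^ 2 - (k / 2 ^ n) ^ 2
            = (((k : ℝ) + 1) / 2 ^ n + k / 2 ^ n) * (1 / 2) ^ n := by
          rw [hba]; ring
        rw [hfac]
        have hpl : 0 ≤ Real.pi * lam := mul_nonneg Real.pi_pos.le hlam
        calc lam * (Real.pi * ((((k : ℝ) + 1) / 2 ^ n + k / 2 ^ n) * (1 / 2) ^ n))
            = Real.pi * lam * ((((k : ℝ) + 1) / 2 ^ n + k / 2 ^ n) * (1 / 2) ^ n) := by ring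
          _ ≤ Real.pi * lam * ((2 * M) * (1 / 2) ^ n) := by gcongr; linarith
          _ = _ := by ring
      refine (Finset.sum_le_sum h2).trans ?_
      rw [Finset.sum_const, Finset.card_range, nsmul_eq_mul, ← ENNReal.ofReal_natCast,
        ← ENNReal.ofReal_mul (by positivity)]
      refine ENNReal.ofReal_le_ofReal (le_of_eq ?_)
      push_cast
      have : (2 : ℝ) ^ n * (1 / 2) ^ n = 1 := by rw [← mul_pow]; norm_num
      linear_combination (M * (Real.pi * lam * 2 * M) ^ 2 * (1 / 2) ^ n) * this
    have h2 : Tendsto (fun n : ℕ => ENNReal.ofReal (M * (Real.pi * lam * 2 * M) ^ 2 * (1 / 2) ^ n))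
        atTop (𝓝 0) := by
      rw [← ENNReal.ofReal_zero]
      refine ENNReal.tendsto_ofReal ?_
      simpa using (tendsto_pow_atTop_nhds_zero_of_lt_one (r := (1 / 2 : ℝ)) (by norm_num)
        (by norm_num)).const_mul (M * (Real.pi * lam * 2 * M) ^ 2)
    exact le_antisymm (ge_of_tendsto' h2 h1) zero_le
  have hall := ae_all_iff.2 fun M => (measure_eq_zero_iff_ae_notMem).1 (key M)
  filter_upwards [hall] with ω hω i j hij
  by_contra hne
  obtain ⟨M, hM⟩ := exists_nat_gt (dist (X i ω) u)
  exact hω M ⟨i, j, hne, hij, hM⟩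

/-- Almost surely there is exactly one nearest point. -/
lemma IsHomogeneousPPP.ae_exists_nearest (hX : IsHomogeneousPPP μ lam X) (hlam : 0 ≤ lam)
    (u : Plane) : ∀ᵐ ω ∂μ, ∃ i, dist (X i ω) u = nearestDist X u ω ∧
      ∀ j, j ≠ i → nearestDist X u ω < dist (X j ω) u := by
  filter_upwards [hX.ae_injective_dist hlam u, hX.ae_finite_ball u] with ω hinj hfin
  obtain ⟨M, hM⟩ := exists_nat_gt (dist (X 0 ω) u)
  obtain ⟨i, hi, hmin⟩ := Set.exists_min_image _ (fun i => dist (X i ω) u) (hfin M) ⟨0, hM⟩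
  have hle : ∀ j, dist (X i ω) u ≤ dist (X j ω) u := by
    intro j
    rcases lt_or_ge (dist (X j ω) u) M with h | h
    · exact hmin j h
    · exact (le_of_lt hi).trans h
  have heq : dist (X i ω) u = nearestDist X u ω :=
    le_antisymm (le_nearestDist_iff.2 hle) (le_nearestDist_iff.1 le_rfl i)
  refine ⟨i, heq, fun j hj => ?_⟩
  rw [← heq]
  exact lt_of_le_of_ne (hle j) fun h => hj (hinj h.symm)

end

/-! ### Coverage under Rayleigh fading for fixed positions. -/

section

/-- The square of a Rayleigh variable is exponential with mean 1. An infinite threshold is allowed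
because the interference may diverge. -/
lemma contactLaw_tail (y : ℝ≥0∞) :
    contactLaw Real.pi⁻¹ {r | y < ENNReal.ofReal (r ^ 2)} = expNeg y := by
  induction y with
  | top => simp
  | coe v =>
    have hpi : 0 < Real.pi⁻¹ := inv_pos.2 Real.pi_pos
    have h1 : {r : ℝ | (v : ℝ≥0∞) < ENNReal.ofReal (r ^ 2)}
        =ᵐ[contactLaw Real.pi⁻¹] Set.Ici √(v : ℝ) := by
      have h2 : Set.Ioi √(v : ℝ) =ᵐ[contactLaw Real.pi⁻¹] Set.Ici √(v : ℝ) :=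
        (contactLaw_absolutelyContinuous _).ae_eq Ioi_ae_eq_Ici
      refine EventuallyEq.trans ?_ h2
      filter_upwards [ae_contactLaw_nonneg Real.pi⁻¹] with r hr
      refine propext ?_
      change ((v : ℝ≥0∞) < ENNReal.ofReal (r ^ 2)) ↔ √(v : ℝ) < r
      rw [Real.sqrt_lt v.coe_nonneg hr, ← ENNReal.ofReal_coe_nnreal,
        ENNReal.ofReal_lt_ofReal_iff_of_nonneg v.coe_nonneg]
    rw [measure_congr h1, contactLaw_Ici hpi (Real.sqrt_nonneg _), Real.sq_sqrt v.coe_nonneg,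
      ← ENNReal.ofReal_coe_nnreal, expNeg_ofReal v.coe_nonneg]
    congr 2
    field_simp

variable {E : Type*} [MeasurableSpace E] {ν : Measure E}

lemma hasLaw_norm {g : E → ℂ} (hg : HasLaw g complexNormal ν) :
    HasLaw (fun x => ‖g x‖) (contactLaw Real.pi⁻¹) ν :=
  ⟨hg.aemeasurable.norm, by
    rw [← map_norm_complexNormal, ← hg.map_eq,
      AEMeasurable.map_map_of_aemeasurable measurable_norm.aemeasurable hg.aemeasurable]
    rfl⟩

/-- The Laplace transform `1 / (1 + c)` of the exponential law, written as `exp (-log (1 + c))` so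
that a product over interferers becomes a sum over points. -/
lemma lintegral_expNeg_normSq {g : E → ℂ} (hg : HasLaw g complexNormal ν) {c : ℝ} (hc : 0 ≤ c) :
    ∫⁻ x, expNeg (ENNReal.ofReal (c * ‖g x‖ ^ 2)) ∂ν
      = expNeg (ENNReal.ofReal (Real.log (1 + c))) := by
  have h1 := hasLaw_norm hg
  rw [h1.lintegral_comp (f := fun r => expNeg (ENNReal.ofReal (c * r ^ 2))) (by fun_prop),
    expNeg_ofReal (Real.log_nonneg (by linarith)), Real.exp_neg, Real.exp_log (by linarith),
    ← one_div (1 + c), ← lintegral_exp_contactLaw (inv_pos.2 Real.pi_pos) hc]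
  refine lintegral_congr fun r => ?_
  rw [expNeg_ofReal (by positivity)]
  congr 3
  field_simp

lemma ae_ne_zero_of_complexNormal {g : E → ℂ} (hg : HasLaw g complexNormal ν) :
    ∀ᵐ x ∂ν, g x ≠ 0 := by
  have h1 := hasLaw_norm hg
  have h2 : ∀ᵐ r ∂(contactLaw Real.pi⁻¹), r ≠ 0 :=
    (contactLaw_absolutelyContinuous _).ae_le (Measure.ae_ne volume 0)
  rw [← h1.map_eq] at h2
  filter_upwards [ae_of_ae_map h1.aemeasurable h2] with x hx
  exact norm_ne_zero_iff.1 hx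

lemma measurable_tsum_ennreal {E : Type*} {m : MeasurableSpace E} {f : ℕ → E → ℝ≥0∞}
    (hf : ∀ j, Measurable (f j)) : Measurable fun x => ∑' j, f j x :=
  Measurable.tsum hf

/-- Since `c i = 0`, the full sum is a function of the channels other than the `i`-th. -/
lemma indepFun_interference {g : ℕ → E → ℂ} (hgm : ∀ i, Measurable (g i))
    (hind : iIndepFun g ν) (i : ℕ) (c : ℕ → ℝ) (hci : c i = 0) :
    IndepFun (fun x => ∑' j, ENNReal.ofReal (c j * ‖g j x‖ ^ 2)) (g i) ν := by
  rw [IndepFun_iff_Indep]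
  have h1 := indep_iSup_of_disjoint (fun j => (hgm j).comap_le) hind.iIndep
    (S := {j | j ≠ i}) (T := {i}) (by simp)
  refine indep_of_indep_of_le_left (indep_of_indep_of_le_right h1 (by simp)) ?_
  rw [← measurable_iff_comap_le]
  refine measurable_tsum_ennreal fun j => ?_
  by_cases hj : j = i
  · subst hj
    simp only [hci, zero_mul, ENNReal.ofReal_zero]
    exact measurable_const
  · have hle : MeasurableSpace.comap (g j) inferInstance
        ≤ ⨆ j ∈ {j | j ≠ i}, MeasurableSpace.comap (g j) inferInstance :=
      le_iSup₂_of_le j hj le_rfl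
    have hz : Measurable fun z : ℂ => ENNReal.ofReal (c j * ‖z‖ ^ 2) := by fun_prop
    exact hz.comp ((comap_measurable (g j)).mono hle le_rfl)

variable [IsProbabilityMeasure ν]

/-- A Rayleigh fading power exceeds an independent threshold `Y` with probability `𝔼 exp (-Y)`. -/
lemma measure_lt_normSq {g : E → ℂ} (hg : HasLaw g complexNormal ν) {Y : E → ℝ≥0∞}
    (hY : Measurable Y) (hind : IndepFun Y g ν) :
    ν {x | Y x < ENNReal.ofReal (‖g x‖ ^ 2)} = ∫⁻ x, expNeg (Y x) ∂ν := by
  have := isProbabilityMeasure_contactLaw (inv_pos.2 Real.pi_pos)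
  have h1 := hasLaw_norm hg
  have hind' : IndepFun Y (fun x => ‖g x‖) ν := hind.comp measurable_id measurable_norm
  have h2 : HasLaw (fun x => (Y x, ‖g x‖)) ((ν.map Y).prod (contactLaw Real.pi⁻¹)) ν :=
    hind'.hasLaw_prod ⟨hY.aemeasurable, rfl⟩ h1
  have hs : MeasurableSet {p : ℝ≥0∞ × ℝ | p.1 < ENNReal.ofReal (p.2 ^ 2)} :=
    measurableSet_lt (by fun_prop) (by fun_prop)
  rw [h2.measure_eq (p := fun p => p.1 < ENNReal.ofReal (p.2 ^ 2)) hs, Measure.prod_apply hs]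
  simp only [Set.preimage_ofPred_eq, contactLaw_tail]
  rw [lintegral_map measurable_expNeg hY]

lemma lintegral_expNeg_interference {g : ℕ → E → ℂ} (hgm : ∀ i, Measurable (g i))
    (hg : ∀ i, HasLaw (g i) complexNormal ν) (hind : iIndepFun g ν) {c : ℕ → ℝ}
    (hc : ∀ i, 0 ≤ c i) :
    ∫⁻ x, expNeg (∑' j, ENNReal.ofReal (c j * ‖g j x‖ ^ 2)) ∂ν
      = expNeg (∑' j, ENNReal.ofReal (Real.log (1 + c j))) := by
  have h1 : Tendsto
      (fun n => ∫⁻ x, expNeg (∑ j ∈ Finset.range n, ENNReal.ofReal (c j * ‖g j x‖ ^ 2)) ∂ν)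
      atTop (𝓝 (∫⁻ x, expNeg (∑' j, ENNReal.ofReal (c j * ‖g j x‖ ^ 2)) ∂ν)) :=
    tendsto_lintegral_expNeg (fun n => by fun_prop)
      (ae_of_all _ fun x => ENNReal.tendsto_nat_tsum _)
  have h2 := (continuous_expNeg.tendsto _).comp
    (ENNReal.tendsto_nat_tsum fun j => ENNReal.ofReal (Real.log (1 + c j)))
  refine tendsto_nhds_unique h1 (h2.congr fun n => ?_)
  simp only [Function.comp_apply, expNeg_sum]
  have hi := hind.comp (fun j z => expNeg (ENNReal.ofReal (c j * ‖z‖ ^ 2))) (fun j => by fun_prop)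
  refine Eq.trans ?_ (lintegral_prod_eq_prod_lintegral_of_indepFun (Finset.range n) _ hi
    (fun j => by fun_prop)).symm
  exact Finset.prod_congr rfl fun j _ => (lintegral_expNeg_normSq (hg j) (hc j)).symm

/-- The coverage probability for fixed link gains under Rayleigh fading. -/
lemma measure_ratio_gt {g : ℕ → E → ℂ} (hgm : ∀ i, Measurable (g i))
    (hg : ∀ i, HasLaw (g i) complexNormal ν) (hind : iIndepFun g ν) {p : ℕ → ℝ}
    (hp : ∀ i, 0 < p i) {P τ : ℝ} (hP : 0 < P) (hτ : 0 < τ) (i : ℕ) :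
    ν {x | ENNReal.ofReal τ < ENNReal.ofReal (P * ‖g i x‖ ^ 2 * p i)
        / ∑' j : {j : ℕ // j ≠ i}, ENNReal.ofReal (P * ‖g j x‖ ^ 2 * p j)}
      = expNeg (∑' j, ({j | j ≠ i} : Set ℕ).indicator
          (fun j => ENNReal.ofReal (Real.log (1 + τ * p j / p i))) j) := by
  let c : ℕ → ℝ := ({j | j ≠ i} : Set ℕ).indicator fun j => τ * p j / p i
  have hc : ∀ j, 0 ≤ c j := fun j => Set.indicator_nonneg
    (fun j _ => div_nonneg (mul_nonneg hτ.le (hp j).le) (hp i).le) j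
  have hci : c i = 0 := Set.indicator_of_notMem (by simp) _
  have h1 : {x | ENNReal.ofReal τ < ENNReal.ofReal (P * ‖g i x‖ ^ 2 * p i)
        / ∑' j : {j : ℕ // j ≠ i}, ENNReal.ofReal (P * ‖g j x‖ ^ 2 * p j)}
      =ᵐ[ν] {x | ∑' j, ENNReal.ofReal (c j * ‖g j x‖ ^ 2) < ENNReal.ofReal (‖g i x‖ ^ 2)} := by
    -- The interference may be infinite, so clearing the denominator in `[0, ∞]` uses a nonzero
    -- numerator, which holds almost surely.
    filter_upwards [ae_ne_zero_of_complexNormal (hg i)] with x hx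
    refine propext ?_
    change _ < _ ↔ _ < _
    have hpos : 0 < ‖g i x‖ := norm_pos_iff.2 hx
    have hpi := hp i
    rw [ENNReal.lt_div_iff_mul_lt (.inr ENNReal.ofReal_ne_top) (.inr (by positivity)),
      ← ENNReal.tsum_mul_left]
    have hs : ∀ j, ({j | j ≠ i} : Set ℕ).indicator
        (fun j => ENNReal.ofReal τ * ENNReal.ofReal (P * ‖g j x‖ ^ 2 * p j)) j
        = ENNReal.ofReal (P * p i) * ENNReal.ofReal (c j * ‖g j x‖ ^ 2) := by
      intro j
      by_cases hj : j ∈ {j | j ≠ i}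
      · simp only [c, Set.indicator_of_mem hj]
        rw [← ENNReal.ofReal_mul hτ.le, ← ENNReal.ofReal_mul (by positivity)]
        congr 1
        field_simp
      · simp only [c, Set.indicator_of_notMem hj]
        simp
    have hts := tsum_subtype {j | j ≠ i} (fun j =>
      ENNReal.ofReal τ * ENNReal.ofReal (P * ‖g j x‖ ^ 2 * p j))
    have hts' := hts.trans ((tsum_congr hs).trans ENNReal.tsum_mul_left)
    rw [show (∑' j : {j : ℕ // j ≠ i}, ENNReal.ofReal τ * ENNReal.ofReal (P * ‖g j x‖ ^ 2 * p j))
      = _ from hts']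
    have h2 : P * ‖g i x‖ ^ 2 * p i = P * p i * ‖g i x‖ ^ 2 := by ring
    rw [h2, ENNReal.ofReal_mul (p := P * p i) (q := ‖g i x‖ ^ 2) (by positivity),
      ENNReal.mul_lt_mul_iff_right (by positivity) ENNReal.ofReal_ne_top]
  rw [measure_congr h1, measure_lt_normSq (hg i) (Measurable.tsum fun j => by fun_prop)
    (indepFun_interference hgm hind i c hci), lintegral_expNeg_interference hgm hg hind hc]
  congr 1
  refine tsum_congr fun j => ?_
  by_cases hj : j ∈ {j | j ≠ i}
  · simp only [c, Set.indicator_of_mem hj]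
  · simp only [c, Set.indicator_of_notMem hj]
    simp

end

/-! ### The coverage probability for an antitone path loss. -/

section

/-- A positive, antitone path loss on `[0, ∞)`. -/
structure IsPathLoss (l : ℝ → ℝ) : Prop where
  measurable : Measurable l
  pos : ∀ r, 0 ≤ r → 0 < l r
  nonneg : ∀ r, 0 ≤ l r
  antitoneOn : AntitoneOn l (Set.Ici 0)

/-- Minus the logarithm of the Laplace transform of the normalized interference power caused by a
point at distance `t` if the serving point is at distance `r`. -/
def interferenceKernel (l : ℝ → ℝ) (τ r t : ℝ) : ℝ≥0∞ :=
  ENNReal.ofReal (Real.log (1 + τ * l t / l r))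

lemma IsPathLoss.measurable_interferenceKernel {l : ℝ → ℝ} (hl : IsPathLoss l) (τ : ℝ) :
    Measurable (Function.uncurry (interferenceKernel l τ)) := by
  have := hl.measurable
  unfold interferenceKernel Function.uncurry
  fun_prop

lemma IsPathLoss.monotoneOn_interferenceKernel {l : ℝ → ℝ} (hl : IsPathLoss l) {τ : ℝ}
    (hτ : 0 < τ) (t : ℝ) : MonotoneOn (fun r => interferenceKernel l τ r t) (Set.Ici 0) := by
  intro r hr s hs hrs
  have h1 := hl.pos s hs
  have h2 := hl.pos r hr
  have h3 := hl.nonneg t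
  have h4 := hl.antitoneOn hr hs hrs
  refine ENNReal.ofReal_le_ofReal (Real.log_le_log (by positivity) ?_)
  gcongr

/-- A monotone function has countably many discontinuities. Composing with `max r 0` makes `l`
antitone on the whole line without changing it near any `r > 0`. -/
lemma IsPathLoss.ae_continuousAt {l : ℝ → ℝ} (hl : IsPathLoss l) :
    ∀ᵐ r, 0 ≤ r → ContinuousAt l r := by
  have h1 : Antitone fun r => l (max r 0) := fun r s hrs =>
    hl.antitoneOn (Set.mem_Ici.2 (le_max_right _ _)) (Set.mem_Ici.2 (le_max_right _ _))
      (max_le_max_right 0 hrs)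
  have h2 := h1.countable_not_continuousAt.ae_notMem volume
  filter_upwards [h2, Measure.ae_ne volume (0 : ℝ)] with r hr hr0 hr1
  have hc : ContinuousAt (fun r => l (max r 0)) r := by simpa using hr
  refine hc.congr ?_
  filter_upwards [lt_mem_nhds (lt_of_le_of_ne hr1 hr0.symm)] with s hs
  rw [max_eq_left hs.le]

lemma IsPathLoss.ae_continuousAt_interferenceKernel {l : ℝ → ℝ} (hl : IsPathLoss l) {τ : ℝ}
    (hτ : 0 < τ) :
    ∀ᵐ r, 0 ≤ r → ∀ t, ContinuousAt (fun r => interferenceKernel l τ r t) r := by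
  filter_upwards [hl.ae_continuousAt] with r hr hr0 t
  have h1 := hl.pos r hr0
  have h2 := hl.nonneg t
  refine ENNReal.continuous_ofReal.continuousAt.comp (ContinuousAt.log ?_ (by positivity))
  exact continuousAt_const.add (continuousAt_const.div (hr hr0) h1.ne')

/-- The pairs of positions and channel coefficients for which the user is covered. -/
def coverageSet (u : Plane) (P : ℝ) (l : ℝ → ℝ) (τ : ℝ) : Set ((ℕ → Plane) × (ℕ → ℂ)) :=
  {p | ∃ i, IsServing (fun i (p : (ℕ → Plane) × (ℕ → ℂ)) => p.1 i) u i p ∧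
    ENNReal.ofReal τ < sir (fun i (p : (ℕ → Plane) × (ℕ → ℂ)) => p.1 i) (fun i p => p.2 i) u P l i p}

lemma measurableSet_coverageSet (u : Plane) (P : ℝ) {l : ℝ → ℝ} (hl : Measurable l) (τ : ℝ) :
    MeasurableSet (coverageSet u P l τ) := by
  unfold coverageSet IsServing sir receivedPower
  refine measurableSet_setOfPred.2 (Measurable.exists fun i => Measurable.and ?_ ?_)
  · refine Measurable.forall fun j => measurableSet_setOfPred.1 (measurableSet_le ?_ ?_) <;> fun_prop
  · refine measurableSet_setOfPred.1 (measurableSet_lt measurable_const (Measurable.div ?_ ?_))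
    · fun_prop
    · exact Measurable.tsum fun j => by fun_prop

/-- A strict nearest point forces the serving index to be `i`, and the indices `j ≠ i` are then
exactly those of the points beyond distance `T`. -/
lemma measure_coverageSet_section {ν : Measure (ℕ → ℂ)} [IsProbabilityMeasure ν]
    (hg : ∀ i : ℕ, HasLaw (fun g : ℕ → ℂ => g i) complexNormal ν)
    (hind : iIndepFun (fun (i : ℕ) (g : ℕ → ℂ) => g i) ν) {l : ℝ → ℝ} (hl : IsPathLoss l)
    {P τ : ℝ} (hP : 0 < P) (hτ : 0 < τ) (u : Plane) (x : ℕ → Plane) {T : ℝ} {i : ℕ}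
    (hi : dist (x i) u = T) (hmin : ∀ j, j ≠ i → T < dist (x j) u) :
    ν (Prod.mk x ⁻¹' coverageSet u P l τ)
      = expNeg (∑' j, (Set.Ioi T).indicator (interferenceKernel l τ T) (dist (x j) u)) := by
  have h1 : Prod.mk x ⁻¹' coverageSet u P l τ
      = {g : ℕ → ℂ | ENNReal.ofReal τ < ENNReal.ofReal (P * ‖g i‖ ^ 2 * l (dist (x i) u))
        / ∑' j : {j : ℕ // j ≠ i}, ENNReal.ofReal (P * ‖g j‖ ^ 2 * l (dist (x j) u))} := by
    ext g
    constructor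
    · rintro ⟨k, hk, hk'⟩
      have : k = i := by
        by_contra hne
        have h2 := hk i
        simp only [hi] at h2
        exact absurd (hmin k hne) (not_lt.2 h2)
      subst this
      exact hk'
    · intro h
      refine ⟨i, fun j => ?_, h⟩
      rcases eq_or_ne j i with rfl | hj
      · exact le_rfl
      · exact hi.le.trans (hmin j hj).le
  rw [h1, measure_ratio_gt (fun i => measurable_pi_apply i) hg hind
    (p := fun j => l (dist (x j) u)) (fun j => hl.pos _ dist_nonneg) hP hτ i]
  congr 1
  refine tsum_congr fun j => ?_
  rcases eq_or_ne j i with rfl | hj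
  · rw [Set.indicator_of_notMem (by simp), Set.indicator_of_notMem (by simp [hi])]
  · rw [Set.indicator_of_mem (by simpa using hj), Set.indicator_of_mem (by simpa using hmin j hj),
      interferenceKernel, hi]

variable {Ω : Type*} [MeasurableSpace Ω]

/-- The coverage probability for a general antitone path loss. -/
lemma IsNetwork.coverageProb_eq {μ : Measure Ω} [IsProbabilityMeasure μ] {lam P τ : ℝ}
    (hlam : 0 < lam) (hP : 0 < P) (hτ : 0 < τ) {X : ℕ → Ω → Plane} {h : ℕ → Ω → ℂ}
    (hnet : IsNetwork μ lam X h) {l : ℝ → ℝ} (hl : IsPathLoss l) (u : Plane) :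
    coverageProb μ X h u P l τ
      = (∫⁻ r, expNeg (∫⁻ t, (1 - expNeg ((Set.Ioi r).indicator (interferenceKernel l τ r) t))
          ∂(radialIntensity lam)) ∂(contactLaw lam)).toReal := by
  have hXm : Measurable fun ω i => X i ω := measurable_pi_lambda _ hnet.ppp.measurable
  have hhm : AEMeasurable (fun ω i => h i ω) μ :=
    aemeasurable_pi_lambda _ fun i => (hnet.hasLaw_channel i).aemeasurable
  -- The `h i` are only almost everywhere measurable; on the sequence space the coordinates are
  -- measurable, with the same joint law.
  set ν := μ.map (fun ω i => h i ω) with hν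
  have hνp : IsProbabilityMeasure ν := Measure.isProbabilityMeasure_map hhm
  have heval : ∀ i : ℕ, HasLaw (fun g : ℕ → ℂ => g i) complexNormal ν := fun i =>
    ⟨(measurable_pi_apply i).aemeasurable, by
      rw [hν, AEMeasurable.map_map_of_aemeasurable (measurable_pi_apply i).aemeasurable hhm,
        ← (hnet.hasLaw_channel i).map_eq]
      rfl⟩
  have hind : iIndepFun (fun (i : ℕ) (g : ℕ → ℂ) => g i) ν := by
    rw [iIndepFun_iff_map_fun_eq_infinitePi_map (fun i => measurable_pi_apply i)]
    simp_rw [fun i => (heval i).map_eq]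
    rw [show (fun (g : ℕ → ℂ) i => g i) = id from rfl, Measure.map_id, hν,
      hnet.iIndepFun_channel.map_fun_eq_infinitePi_map₀ hhm]
    simp_rw [fun i => (hnet.hasLaw_channel i).map_eq]
  have hlaw : HasLaw (fun ω => ((fun i => X i ω), (fun i => h i ω)))
      ((μ.map fun ω i => X i ω).prod ν) μ :=
    hnet.indepFun.hasLaw_prod ⟨hXm.aemeasurable, rfl⟩ ⟨hhm, rfl⟩
  have hS := measurableSet_coverageSet u P hl.measurable τ
  rw [← hnet.ppp.laplace_beyond_nearest hlam u (hl.measurable_interferenceKernel τ)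
    (hl.monotoneOn_interferenceKernel hτ) (hl.ae_continuousAt_interferenceKernel hτ),
    coverageProb, Measure.real]
  congr 1
  refine (hlaw.measure_eq (p := fun p => p ∈ coverageSet u P l τ) hS).trans ?_
  rw [Set.ofPred_mem_eq, Measure.prod_apply hS, lintegral_map (measurable_measure_prodMk_left hS) hXm]
  refine lintegral_congr_ae ?_
  filter_upwards [hnet.ppp.ae_exists_nearest hlam.le u] with ω ⟨i, hi, hmin⟩
  exact measure_coverageSet_section heval hind hl hP hτ u _ hi hmin

end

/-! ### Euler's integral for `₂F₁(1, b; 1 + b; z)` -/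

/-- Euler's integral for `₂F₁(1, b; 1 + b; z)`. -/
def eulerIntegral (b : ℝ) (z : ℂ) : ℂ :=
  ∫ u in Set.Ioc (0 : ℝ) 1, ((b * u ^ (b - 1) : ℝ) : ℂ) / (1 - z * u)

lemma integrableOn_eulerWeight {b : ℝ} (hb : 0 < b) :
    IntegrableOn (fun u : ℝ => b * u ^ (b - 1)) (Set.Ioc 0 1) :=
  ((intervalIntegrable_iff_integrableOn_Ioc_of_le zero_le_one).1
    (intervalIntegral.intervalIntegrable_rpow' (by linarith))).const_mul b

lemma one_sub_mul_ne_zero {z : ℂ} (hz : z ∈ cutPlane) {u : ℝ} (hu : u ∈ Set.Icc (0 : ℝ) 1) :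
    1 - z * u ≠ 0 := by
  intro h
  have hre := congrArg Complex.re h
  have him := congrArg Complex.im h
  simp only [Complex.sub_re, Complex.one_re, Complex.mul_re, Complex.ofReal_re, Complex.ofReal_im,
    mul_zero, sub_zero, Complex.zero_re, Complex.sub_im, Complex.one_im, Complex.mul_im,
    Complex.zero_im, zero_add, zero_sub, neg_eq_zero, mul_eq_zero] at hre him
  have hu0 : u ≠ 0 := by rintro rfl; simp at hre
  have hz2 : z.im = 0 := him.resolve_right hu0
  rcases hz with h1 | h1
  · simp only [Complex.sub_re, Complex.one_re] at h1
    have := mul_pos (lt_of_le_of_ne hu.1 hu0.symm) h1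
    nlinarith [hu.2]
  · simp [hz2] at h1

lemma isOpen_cutPlane : IsOpen cutPlane :=
  Complex.isOpen_slitPlane.preimage (by fun_prop)

/-- Differentiation under the integral sign. Near `z₀` the modulus of `1 - z u` has a positive
minimum `m` by compactness, which dominates the derivative by the integrable weight times `1 / m ^
2`. -/
lemma differentiableOn_eulerIntegral {b : ℝ} (hb : 0 < b) :
    DifferentiableOn ℂ (eulerIntegral b) cutPlane := by
  intro z₀ hz₀
  obtain ⟨ε, hε, hball⟩ := Metric.nhds_basis_closedBall.mem_iff.1 (isOpen_cutPlane.mem_nhds hz₀)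
  have hcomp : IsCompact (Metric.closedBall z₀ ε ×ˢ Set.Icc (0 : ℝ) 1) :=
    (isCompact_closedBall z₀ ε).prod isCompact_Icc
  obtain ⟨⟨z₁, u₁⟩, h₁, hmin⟩ := hcomp.exists_isMinOn
    (f := fun p : ℂ × ℝ => ‖1 - p.1 * p.2‖) ⟨(z₀, 0), by simp [hε.le]⟩ (by fun_prop)
  set m := ‖1 - z₁ * u₁‖ with hm
  have hmpos : 0 < m := norm_pos_iff.2 (one_sub_mul_ne_zero (hball h₁.1) h₁.2)
  have hmle : ∀ z ∈ Metric.closedBall z₀ ε, ∀ u ∈ Set.Ioc (0 : ℝ) 1, m ≤ ‖1 - z * u‖ :=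
    fun z hz u hu => hmin (a := (z, u)) ⟨hz, hu.1.le, hu.2⟩
  have hw := integrableOn_eulerWeight hb
  have hwm : ∀ F : ℂ → ℂ, Measurable F → AEStronglyMeasurable
      (fun u : ℝ => ((b * u ^ (b - 1) : ℝ) : ℂ) * F u) (volume.restrict (Set.Ioc (0 : ℝ) 1)) := by
    intro F hF
    have : Measurable fun u : ℝ => ((b * u ^ (b - 1) : ℝ) : ℂ) * F u := by fun_prop
    exact this.aestronglyMeasurable
  have key := hasDerivAt_integral_of_dominated_loc_of_deriv_le
    (μ := volume.restrict (Set.Ioc (0 : ℝ) 1)) (x₀ := z₀)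
    (F := fun z (u : ℝ) => ((b * u ^ (b - 1) : ℝ) : ℂ) / (1 - z * u))
    (F' := fun z (u : ℝ) => ((b * u ^ (b - 1) : ℝ) : ℂ) * (u / (1 - z * u) ^ 2))
    (bound := fun u => b * u ^ (b - 1) * (1 / m ^ 2))
    (Metric.closedBall_mem_nhds z₀ hε) ?_ ?_ ?_ ?_ ?_ ?_
  · exact key.2.differentiableAt.differentiableWithinAt
  · refine Eventually.of_forall fun z => ?_
    simp_rw [div_eq_mul_inv]
    exact hwm (fun u => (1 - z * u)⁻¹) (by fun_prop)
  · refine Integrable.mono' (hw.mul_const (1 / m)) ?_ ?_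
    · simp_rw [div_eq_mul_inv]
      exact hwm (fun u => (1 - z₀ * u)⁻¹) (by fun_prop)
    · refine (ae_restrict_iff' measurableSet_Ioc).2 (ae_of_all _ fun u hu => ?_)
      have hnn : 0 ≤ b * u ^ (b - 1) := mul_nonneg hb.le (Real.rpow_nonneg hu.1.le _)
      rw [norm_div, Complex.norm_real, Real.norm_of_nonneg hnn, mul_one_div]
      exact div_le_div_of_nonneg_left hnn hmpos
        (hmle z₀ (Metric.mem_closedBall_self hε.le) u hu)
  · exact hwm (fun u => u / (1 - z₀ * u) ^ 2) (by fun_prop)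
  · refine (ae_restrict_iff' measurableSet_Ioc).2 (ae_of_all _ fun u hu z hz => ?_)
    have hnn : 0 ≤ b * u ^ (b - 1) := mul_nonneg hb.le (Real.rpow_nonneg hu.1.le _)
    rw [norm_mul, Complex.norm_real, Real.norm_of_nonneg hnn, norm_div, norm_pow,
      Complex.norm_real, Real.norm_of_nonneg hu.1.le]
    have := hmle z hz u hu
    gcongr
    exact hu.2
  · exact hw.mul_const _
  · refine (ae_restrict_iff' measurableSet_Ioc).2 (ae_of_all _ fun u hu z hz => ?_)
    have hne := one_sub_mul_ne_zero (hball hz) ⟨hu.1.le, hu.2⟩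
    have h1 : HasDerivAt (fun z : ℂ => 1 - z * u) (-(1 * (u : ℂ))) z :=
      ((hasDerivAt_id z).mul_const (u : ℂ)).const_sub 1
    have h2 := (h1.inv hne).const_mul ((b * u ^ (b - 1) : ℝ) : ℂ)
    simp_rw [div_eq_mul_inv]
    refine h2.congr_deriv ?_
    rw [one_mul, neg_neg, div_eq_mul_inv]

lemma integral_eulerWeight_mul_pow {b : ℝ} (hb : 0 < b) (n : ℕ) :
    ∫ u in Set.Ioc (0 : ℝ) 1, b * u ^ (b - 1) * u ^ n = b / (b + n) := by
  have h1 : ∀ u ∈ Set.Ioc (0 : ℝ) 1, b * u ^ (b - 1) * u ^ n = b * u ^ (b - 1 + n) := by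
    intro u hu
    rw [Real.rpow_add_natCast hu.1.ne', mul_assoc]
  have h0 : (0 : ℝ) ≤ n := Nat.cast_nonneg n
  rw [setIntegral_congr_fun measurableSet_Ioc h1, integral_const_mul,
    ← intervalIntegral.integral_of_le zero_le_one, integral_rpow (.inl (by linarith)),
    Real.one_rpow, Real.zero_rpow (by linarith), sub_zero, mul_one_div]
  congr 1
  ring

/-- Splitting off the first or the last factor of `(b)_{n+1}` gives `b (1 + b)_n = (b)_n (b + n)`.
-/
lemma ascPochhammer_quotient {b : ℝ} (hb : 0 < b) (n : ℕ) :
    (ascPochhammer ℂ n).eval (b : ℂ) * ((ascPochhammer ℂ n).eval ((1 + b : ℝ) : ℂ))⁻¹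
      = ((b / (b + n) : ℝ) : ℂ) := by
  have hne : ∀ k : ℕ, ((b : ℂ) + k) ≠ 0 := by
    intro k
    have : (0 : ℝ) ≤ k := Nat.cast_nonneg k
    have : b + k ≠ 0 := by positivity
    exact_mod_cast this
  have hpos : (ascPochhammer ℂ n).eval ((1 + b : ℝ) : ℂ) ≠ 0 := by
    have h1 : (ascPochhammer ℂ n).eval ((1 + b : ℝ) : ℂ)
        = (((ascPochhammer ℝ n).eval (1 + b) : ℝ) : ℂ) := by
      rw [← ascPochhammer_map (algebraMap ℝ ℂ)]
      exact Polynomial.eval_map_algebraMap _ _ |>.trans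
        (Polynomial.aeval_algebraMap_apply_eq_algebraMap_eval _ _)
    rw [h1]
    exact_mod_cast (ascPochhammer_pos n (1 + b) (by linarith)).ne'
  have h2 : (ascPochhammer ℂ (n + 1)).eval (b : ℂ) =
      b * (ascPochhammer ℂ n).eval ((1 + b : ℝ) : ℂ) := by
    rw [ascPochhammer_succ_left]
    simp [add_comm]
  rw [ascPochhammer_succ_eval] at h2
  push_cast
  push_cast at hpos h2
  rw [← div_eq_mul_inv, div_eq_div_iff hpos (hne n)]
  exact h2

/-- Expand `1 / (1 - z u)` as a geometric series and integrate termwise; the `n`-th coefficient is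
`b / (b + n)`, so the series is dominated by that of `‖z‖ ^ n`. -/
lemma eulerIntegral_eq_hypergeometric {b : ℝ} (hb : 0 < b) {z : ℂ} (hz : ‖z‖ < 1) :
    eulerIntegral b z = ordinaryHypergeometric (1 : ℂ) (b : ℂ) ((1 + b : ℝ) : ℂ) z := by
  have hw := integrableOn_eulerWeight hb
  have hnn : ∀ u ∈ Set.Ioc (0 : ℝ) 1, 0 ≤ b * u ^ (b - 1) := fun u hu =>
    mul_nonneg hb.le (Real.rpow_nonneg hu.1.le _)
  let F : ℕ → ℝ → ℂ := fun n u => z ^ n * ((b * u ^ (b - 1) * u ^ n : ℝ) : ℂ)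
  have hint : ∀ n : ℕ, IntegrableOn (fun u : ℝ => b * u ^ (b - 1) * u ^ n) (Set.Ioc 0 1) := by
    intro n
    refine Integrable.mono' hw (Measurable.aestronglyMeasurable (by fun_prop)) ?_
    refine (ae_restrict_iff' measurableSet_Ioc).2 (ae_of_all _ fun u hu => ?_)
    rw [Real.norm_of_nonneg (mul_nonneg (hnn u hu) (pow_nonneg hu.1.le n))]
    exact mul_le_of_le_one_right (hnn u hu) (pow_le_one₀ hu.1.le hu.2)
  have hFint : ∀ n, Integrable (F n) (volume.restrict (Set.Ioc 0 1)) := fun n =>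
    ((hint n).ofReal (𝕜 := ℂ)).const_mul (z ^ n)
  have hFval : ∀ n, ∫ u in Set.Ioc (0 : ℝ) 1, F n u = z ^ n * ((b / (b + n) : ℝ) : ℂ) := by
    intro n
    simp only [F]
    rw [integral_const_mul, integral_complex_ofReal, integral_eulerWeight_mul_pow hb]
  have hFnorm : ∀ n, ∫ u in Set.Ioc (0 : ℝ) 1, ‖F n u‖ = ‖z‖ ^ n * (b / (b + n)) := by
    intro n
    rw [← integral_eulerWeight_mul_pow hb, ← integral_const_mul]
    refine setIntegral_congr_fun measurableSet_Ioc fun u hu => ?_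
    simp only [F]
    rw [norm_mul, norm_pow, Complex.norm_real,
      Real.norm_of_nonneg (mul_nonneg (hnn u hu) (pow_nonneg hu.1.le n))]
  have hsum : Summable fun n => ∫ u in Set.Ioc (0 : ℝ) 1, ‖F n u‖ := by
    simp_rw [hFnorm]
    refine Summable.of_nonneg_of_le (fun n => by positivity) (fun n => ?_)
      (summable_geometric_of_lt_one (norm_nonneg z) hz)
    refine mul_le_of_le_one_right (by positivity) (div_le_one_of_le₀ ?_ (by positivity))
    exact le_add_of_nonneg_right (Nat.cast_nonneg n)
  have h1 := (hasSum_integral_of_summable_integral_norm hFint hsum).tsum_eq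
  rw [ordinaryHypergeometric_eq_tsum]
  have h2 : ∫ u in Set.Ioc (0 : ℝ) 1, ∑' n, F n u = eulerIntegral b z := by
    refine setIntegral_congr_fun measurableSet_Ioc fun u hu => ?_
    have h3 : ∀ n, F n u = ((b * u ^ (b - 1) : ℝ) : ℂ) * (z * u) ^ n := by
      intro n
      simp only [F]
      push_cast
      ring
    simp_rw [h3]
    rw [tsum_mul_left, tsum_geometric_of_norm_lt_one, div_eq_mul_inv]
    rw [norm_mul, Complex.norm_real, Real.norm_of_nonneg hu.1.le]
    exact (mul_le_of_le_one_right (norm_nonneg z) hu.2).trans_lt hz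
  rw [← h2, ← h1]
  refine tsum_congr fun n => ?_
  rw [hFval, ascPochhammer_eval_one, inv_mul_cancel₀ (by exact_mod_cast n.factorial_ne_zero), one_mul,
    ascPochhammer_quotient hb, smul_eq_mul, mul_comm]

/-! ### The functions `ω₂` and `δ` as primitives of the interference integrand. -/

/-- The incomplete integral `∫₀ˣ v ^ (b - 1) / (1 + v) dv`. -/
def hyperPrimitive (b x : ℝ) : ℝ := ∫ v in (0 : ℝ)..x, v ^ (b - 1) / (1 + v)

/-- By uniqueness of the branch, `gauss2F1` is Euler's integral; substitute `v = x u`. Both `ω₁` and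
`ω₂` have this shape, with `b = 1 - 2 / y` and `b = 2 / y`. -/
lemma gauss2F1_one_eq {b : ℝ} (hb : 0 < b) {x : ℝ} (hx : 0 < x) :
    (gauss2F1 1 (b : ℂ) ((1 + b : ℝ) : ℂ) ((-x : ℝ) : ℂ)).re = b * x ^ (-b) * hyperPrimitive b x := by
  have hE : IsGaussHypergeometric 1 (b : ℂ) ((1 + b : ℝ) : ℂ) (eulerIntegral b) :=
    ⟨(differentiableOn_eulerIntegral hb).analyticOnNhd isOpen_cutPlane,
      fun z hz => eulerIntegral_eq_hypergeometric hb hz⟩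
  have hex : ∃ f : ℂ → ℂ, IsGaussHypergeometric 1 (b : ℂ) ((1 + b : ℝ) : ℂ) f := ⟨_, hE⟩
  have hmem : ((-x : ℝ) : ℂ) ∈ cutPlane := by
    left
    simp
    linarith
  rw [gauss2F1, dif_pos hex, hex.choose_spec.eqOn hE hmem, eulerIntegral]
  have h1 : ∀ u : ℝ, ((b * u ^ (b - 1) : ℝ) : ℂ) / (1 - ((-x : ℝ) : ℂ) * u)
      = ((b * u ^ (b - 1) / (1 + x * u) : ℝ) : ℂ) := by
    intro u
    push_cast
    ring
  simp_rw [h1]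
  rw [integral_complex_ofReal, Complex.ofReal_re, ← intervalIntegral.integral_of_le zero_le_one,
    hyperPrimitive]
  have h2 := intervalIntegral.smul_integral_comp_mul_left (a := 0) (b := 1)
    (fun v : ℝ => v ^ (b - 1) / (1 + v)) x
  rw [mul_zero, mul_one] at h2
  rw [← h2, smul_eq_mul, ← mul_assoc, ← intervalIntegral.integral_const_mul]
  refine intervalIntegral.integral_congr fun u hu => ?_
  rw [Set.uIcc_of_le zero_le_one] at hu
  rw [Real.mul_rpow hx.le hu.1, Real.rpow_sub_one hx.ne', Real.rpow_neg hx.le]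
  have : 0 < x ^ b := Real.rpow_pos_of_pos hx b
  field_simp

lemma intervalIntegrable_hyperPrimitive {b x : ℝ} (hb : 0 < b) (hx : 0 ≤ x) :
    IntervalIntegrable (fun v : ℝ => v ^ (b - 1) / (1 + v)) volume 0 x := by
  simp_rw [div_eq_mul_inv]
  refine (intervalIntegral.intervalIntegrable_rpow' (by linarith)).mul_continuousOn ?_
  rw [Set.uIcc_of_le hx]
  refine ContinuousOn.inv₀ (by fun_prop) fun v hv => ?_
  have := hv.1
  positivity

lemma hasDerivAt_hyperPrimitive {b x : ℝ} (hb : 0 < b) (hx : 0 < x) :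
    HasDerivAt (hyperPrimitive b) (x ^ (b - 1) / (1 + x)) x := by
  refine intervalIntegral.integral_hasDerivAt_right (intervalIntegrable_hyperPrimitive hb hx.le)
    (Measurable.stronglyMeasurable (by fun_prop)).stronglyMeasurableAtFilter ?_
  exact (Real.continuousAt_rpow_const _ _ (.inl hx.ne')).div (by fun_prop) (by positivity)

lemma tendsto_hyperPrimitive_zero {b : ℝ} (hb : 0 < b) :
    Tendsto (hyperPrimitive b) (𝓝[>] 0) (𝓝 0) := by
  have h1 := (intervalIntegral.continuousOn_primitive_interval'
    (intervalIntegrable_hyperPrimitive hb zero_le_one) Set.left_mem_uIcc) 0 Set.left_mem_uIcc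
  rw [ContinuousWithinAt, intervalIntegral.integral_same, Set.uIcc_of_le zero_le_one] at h1
  refine h1.mono_left ?_
  rw [← nhdsWithin_Ioo_eq_nhdsGT (zero_lt_one (α := ℝ))]
  exact nhdsWithin_mono _ Set.Ioo_subset_Icc_self

/-- The factor `S ^ 2` cancels the power `(S ^ a) ^ (-2 / a)` from Euler's integral, so `S` survives
only in the limit of integration. -/
lemma boundaryTerm_eq {c a S : ℝ} (hc : 0 < c) (ha : 0 < a) (hS : 0 < S) :
    boundaryTerm c a S = 2 / a * c ^ (2 / a) * hyperPrimitive (2 / a) (S ^ a / c) := by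
  have hSa : 0 < S ^ a := Real.rpow_pos_of_pos hS a
  rw [boundaryTerm, omega2, if_neg ha.ne', gauss2F1_one_eq (by positivity) (by positivity),
    Real.div_rpow hSa.le hc.le, ← Real.rpow_mul hS.le, Real.rpow_neg hc.le]
  have h1 : a * -(2 / a) = -2 := by field_simp
  rw [h1, Real.rpow_neg hS.le, Real.rpow_two]
  field_simp

lemma hasDerivAt_boundaryTerm {c a S : ℝ} (hc : 0 < c) (ha : 0 ≤ a) (hS : 0 < S) :
    HasDerivAt (boundaryTerm c a) (2 * S / (1 + S ^ a / c)) S := by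
  rcases ha.eq_or_lt with rfl | ha
  · have h1 : boundaryTerm c 0 = fun S => S ^ 2 * (1 / (1 + 1 / c)) := by
      ext S
      rw [boundaryTerm, omega2, if_pos rfl, Real.rpow_zero]
    rw [h1, Real.rpow_zero]
    refine ((hasDerivAt_pow 2 S).mul_const _).congr_deriv ?_
    simp [div_eq_mul_inv]
  · have hSa : 0 < S ^ a := Real.rpow_pos_of_pos hS a
    have h1 : HasDerivAt (fun S => 2 / a * c ^ (2 / a) * hyperPrimitive (2 / a) (S ^ a / c))
        (2 / a * c ^ (2 / a) * ((S ^ a / c) ^ (2 / a - 1) / (1 + S ^ a / c)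
          * (a * S ^ (a - 1) / c))) S :=
      ((hasDerivAt_hyperPrimitive (b := 2 / a) (by positivity)
        (by positivity : 0 < S ^ a / c)).comp S
        ((Real.hasDerivAt_rpow_const (.inl hS.ne')).div_const c)).const_mul _
    refine (h1.congr_of_eventuallyEq ?_).congr_deriv ?_
    · filter_upwards [lt_mem_nhds hS] with s hs using boundaryTerm_eq hc ha hs
    · have h2 : a * (2 / a) = 2 := by field_simp
      rw [Real.rpow_sub_one (by positivity), Real.div_rpow hSa.le hc.le, ← Real.rpow_mul hS.le, h2,
        Real.rpow_sub_one hS.ne', Real.rpow_two]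
      have := Real.rpow_pos_of_pos hc (2 / a)
      field_simp

lemma sq_mul_delta_eq {c a S : ℝ} (hc : 0 < c) (ha : 2 < a) (hS : 0 < S) :
    S ^ 2 * delta (c / S ^ a) a
      = 2 / a * c ^ (2 / a) * hyperPrimitive (1 - 2 / a) (c / S ^ a) := by
  have hSa : 0 < S ^ a := Real.rpow_pos_of_pos hS a
  have ha0 : 0 < a := by linarith
  have hb : 0 < 1 - 2 / a := by
    rw [sub_pos, div_lt_one ha0]
    exact ha
  have hg := gauss2F1_one_eq hb (x := c / S ^ a) (by positivity)
  rw [show 1 + (1 - 2 / a) = 2 - 2 / a by ring] at hg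
  rw [delta, omega1, hg, neg_sub, Real.rpow_sub_one (by positivity), Real.div_rpow hc.le hSa.le,
    ← Real.rpow_mul hS.le]
  have h1 : a * (2 / a) = 2 := by field_simp
  have h2 : 1 - 2 / a = (a - 2) / a := by field_simp
  have h3 : a - 2 ≠ 0 := by linarith
  rw [h1, Real.rpow_two]
  generalize hyperPrimitive (1 - 2 / a) (c / S ^ a) = V
  rw [h2]
  field_simp

lemma hasDerivAt_sq_mul_delta {c a S : ℝ} (hc : 0 < c) (ha : 2 < a) (hS : 0 < S) :
    HasDerivAt (fun S => S ^ 2 * delta (c / S ^ a) a) (-(2 * S / (1 + S ^ a / c))) S := by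
  have hSa : 0 < S ^ a := Real.rpow_pos_of_pos hS a
  have ha0 : 0 < a := by linarith
  have hb : 0 < 1 - 2 / a := by
    rw [sub_pos, div_lt_one ha0]
    exact ha
  have h0 : HasDerivAt (fun S : ℝ => c / S ^ a) (c * (-(a * S ^ (a - 1)) / (S ^ a) ^ 2)) S := by
    simp_rw [div_eq_mul_inv c]
    exact (((Real.hasDerivAt_rpow_const (.inl hS.ne')).fun_inv hSa.ne').const_mul c)
  have h1 := ((hasDerivAt_hyperPrimitive hb (by positivity : 0 < c / S ^ a)).comp S h0).const_mul
    (2 / a * c ^ (2 / a))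
  refine (h1.congr_of_eventuallyEq ?_).congr_deriv ?_
  · filter_upwards [lt_mem_nhds hS] with s hs using sq_mul_delta_eq hc ha hs
  · have h2 : a * -(2 / a) = -2 := by field_simp
    have h3 : 1 - 2 / a - 1 = -(2 / a) := by ring
    rw [h3, Real.div_rpow hc.le hSa.le, ← Real.rpow_mul hS.le, h2, Real.rpow_neg hS.le,
      Real.rpow_neg hc.le, Real.rpow_sub_one hS.ne', Real.rpow_two]
    have := Real.rpow_pos_of_pos hc (2 / a)
    field_simp
    ring

lemma tendsto_sq_mul_delta {c a : ℝ} (hc : 0 < c) (ha : 2 < a) :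
    Tendsto (fun S => S ^ 2 * delta (c / S ^ a) a) atTop (𝓝 0) := by
  have ha0 : 0 < a := by linarith
  have hb : 0 < 1 - 2 / a := by
    rw [sub_pos, div_lt_one ha0]
    exact ha
  have h1 : Tendsto (fun S : ℝ => c / S ^ a) atTop (𝓝[>] 0) := by
    refine tendsto_nhdsWithin_iff.2 ⟨(tendsto_rpow_atTop ha0).const_div_atTop c, ?_⟩
    filter_upwards [eventually_gt_atTop 0] with S hS
    exact div_pos hc (Real.rpow_pos_of_pos hS a)
  have h2 := ((tendsto_hyperPrimitive_zero hb).comp h1).const_mul (2 / a * c ^ (2 / a))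
  rw [mul_zero] at h2
  refine h2.congr' ?_
  filter_upwards [eventually_gt_atTop 0] with S hS using (sq_mul_delta_eq hc ha hS).symm

/-- The sum of the inner and the outer term does not depend on `S`. -/
lemma boundaryTerm_add_sq_mul_delta {c a S T : ℝ} (hc : 0 < c) (ha : 2 < a) (hS : 0 < S)
    (hT : 0 < T) :
    boundaryTerm c a S + S ^ 2 * delta (c / S ^ a) a
      = boundaryTerm c a T + T ^ 2 * delta (c / T ^ a) a := by
  have hd : ∀ s ∈ Set.Ioi (0 : ℝ),
      HasDerivAt (fun s => boundaryTerm c a s + s ^ 2 * delta (c / s ^ a) a) 0 s := fun s hs =>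
    ((hasDerivAt_boundaryTerm hc (by linarith) hs).add
      (hasDerivAt_sq_mul_delta hc ha hs)).congr_deriv (by ring)
  exact (convex_Ioi (0 : ℝ)).is_const_of_fderivWithin_eq_zero (𝕜 := ℝ)
    (fun s hs => (hd s hs).differentiableAt.differentiableWithinAt)
    (fun s hs => by
      rw [fderivWithin_of_isOpen isOpen_Ioi hs]
      ext
      simp [(hd s hs).deriv]) hS hT

/-- The invariant sum of boundary term and `δ`-term is read off at `S`, while its `δ`-term vanishes
at infinity. -/
lemma tendsto_boundaryTerm {c a S : ℝ} (hc : 0 < c) (ha : 2 < a) (hS : 0 < S) :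
    Tendsto (boundaryTerm c a) atTop (𝓝 (boundaryTerm c a S + S ^ 2 * delta (c / S ^ a) a)) := by
  have h1 := tendsto_const_nhds (x := boundaryTerm c a S + S ^ 2 * delta (c / S ^ a) a)
    (f := (atTop : Filter ℝ)) |>.sub (tendsto_sq_mul_delta hc ha)
  rw [sub_zero] at h1
  refine h1.congr' ?_
  filter_upwards [eventually_gt_atTop 0] with T hT
  rw [boundaryTerm_add_sq_mul_delta hc ha hS hT, add_sub_cancel_right]

lemma tendsto_boundaryTerm_limUnder {c a : ℝ} (hc : 0 < c) (ha : 2 < a) :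
    Tendsto (boundaryTerm c a) atTop (𝓝 (limUnder atTop (boundaryTerm c a))) :=
  tendsto_nhds_limUnder ⟨_, tendsto_boundaryTerm hc ha one_pos⟩

lemma limUnder_boundaryTerm {c a S : ℝ} (hc : 0 < c) (ha : 2 < a) (hS : 0 < S) :
    limUnder atTop (boundaryTerm c a) = boundaryTerm c a S + S ^ 2 * delta (c / S ^ a) a :=
  (tendsto_boundaryTerm hc ha hS).limUnder_eq

/-! ### The multi-slope path loss and integration slope by slope. -/

section

lemma antennaDist_pos {Δh : ℝ} (hΔh : 0 < Δh) (r : ℝ) : 0 < antennaDist Δh r :=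
  Real.sqrt_pos.2 (by positivity)

lemma sq_antennaDist (Δh r : ℝ) : antennaDist Δh r ^ 2 = r ^ 2 + Δh ^ 2 :=
  Real.sq_sqrt (by positivity)

lemma le_antennaDist (Δh r : ℝ) : r ≤ antennaDist Δh r :=
  Real.le_sqrt_of_sq_le (by nlinarith [sq_nonneg Δh])

lemma antennaDist_le {Δh r s : ℝ} (hr : 0 ≤ r) (hrs : r ≤ s) :
    antennaDist Δh r ≤ antennaDist Δh s :=
  Real.sqrt_le_sqrt (by gcongr)

lemma hasDerivAt_antennaDist {Δh : ℝ} (hΔh : 0 < Δh) (r : ℝ) :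
    HasDerivAt (antennaDist Δh) (r / antennaDist Δh r) r := by
  have h1 : HasDerivAt (fun r : ℝ => r ^ 2 + Δh ^ 2) (2 * r) r := by
    simpa using (hasDerivAt_pow 2 r).add_const (Δh ^ 2)
  refine (h1.sqrt (by positivity)).congr_deriv ?_
  rw [antennaDist, mul_div_mul_left _ _ two_ne_zero]

lemma continuous_antennaDist (Δh : ℝ) : Continuous (antennaDist Δh) := by
  unfold antennaDist
  fun_prop

@[fun_prop]
lemma measurable_antennaDist (Δh : ℝ) : Measurable (antennaDist Δh) :=
  (continuous_antennaDist Δh).measurable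

lemma tendsto_antennaDist (Δh : ℝ) : Tendsto (antennaDist Δh) atTop atTop :=
  tendsto_atTop_mono (le_antennaDist Δh) tendsto_id

variable {N : ℕ} {α R : ℕ → ℝ}

lemma measurableSet_slopeRegion (N : ℕ) (R : ℕ → ℝ) (n : ℕ) : MeasurableSet (slopeRegion N R n) := by
  by_cases h : n + 1 < N
  · have : slopeRegion N R n = Set.Ico (R n) (R (n + 1)) := by
      ext r
      simp [slopeRegion, h]
    rw [this]
    exact measurableSet_Ico
  · have : slopeRegion N R n = Set.Ici (R n) := by
      ext r
      simp [slopeRegion, h]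
    rw [this]
    exact measurableSet_Ici

namespace IsMultiSlope

lemma R_lt_of_lt (hs : IsMultiSlope N α R) {m n : ℕ} (hmn : m < n) (hn : n < N) : R m < R n := by
  induction n, hmn using Nat.le_induction with
  | base => exact hs.R_lt m hn
  | succ k hk ih => exact (ih (by omega)).trans (hs.R_lt k hn)

lemma R_nonneg (hs : IsMultiSlope N α R) {n : ℕ} (hn : n < N) : 0 ≤ R n := by
  rcases Nat.eq_zero_or_pos n with rfl | h
  · exact hs.R_zero.ge
  · exact hs.R_zero.ge.trans (hs.R_lt_of_lt h hn).le

lemma R_pos (hs : IsMultiSlope N α R) {n : ℕ} (h : 0 < n) (hn : n < N) : 0 < R n :=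
  hs.R_zero.ge.trans_lt (hs.R_lt_of_lt h hn)

lemma α_nonneg (hs : IsMultiSlope N α R) {n : ℕ} (hn : n < N) : 0 ≤ α n := by
  induction n with
  | zero => exact hs.α_zero
  | succ k ih => exact (ih (by omega)).trans (hs.α_le k hn)

lemma slopeCoeff_pos (hs : IsMultiSlope N α R) {n : ℕ} (hn : n < N) : 0 < slopeCoeff α R n := by
  refine Finset.prod_pos fun i hi => Real.rpow_pos_of_pos ?_ _
  rw [Finset.mem_Icc] at hi
  exact hs.R_pos (by omega) (by omega)

lemma le_of_mem_slopeRegion (hs : IsMultiSlope N α R) {m n : ℕ} (hm : m < N) {r s : ℝ}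
    (hr : r ∈ slopeRegion N R m) (hsn : s ∈ slopeRegion N R n) (hrs : r ≤ s) (hn : n < N) :
    m ≤ n := by
  by_contra! h
  have h1 : s < R (n + 1) := hsn.2 (by omega)
  have h2 : R (n + 1) ≤ R m := by
    rcases eq_or_lt_of_le (Nat.succ_le_of_lt h) with h' | h'
    · rw [← h']
    · exact (hs.R_lt_of_lt h' hm).le
  linarith [hr.1]

lemma exists_mem_slopeRegion (hs : IsMultiSlope N α R) {r : ℝ} (hr : 0 ≤ r) :
    ∃ n < N, r ∈ slopeRegion N R n := by
  have h1 := hs.one_le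
  have hP : R 0 ≤ r := hs.R_zero.le.trans hr
  let n := Nat.findGreatest (fun n => R n ≤ r) (N - 1)
  have hn : n ≤ N - 1 := Nat.findGreatest_le _
  refine ⟨n, by omega, Nat.findGreatest_spec (P := fun n => R n ≤ r) (Nat.zero_le _) hP,
    fun h => ?_⟩
  have := Nat.findGreatest_is_greatest (P := fun n => R n ≤ r) (n := N - 1) (k := n + 1)
    (Nat.lt_succ_self n) (by omega)
  exact not_le.1 this

lemma pairwiseDisjoint_slopeRegion (hs : IsMultiSlope N α R) :
    Set.PairwiseDisjoint (↑(Finset.range N)) (slopeRegion N R) := by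
  intro m hm n hn hmn
  refine Set.disjoint_left.2 fun r hr hr' => hmn ?_
  simp only [Finset.coe_range, Set.mem_Iio] at hm hn
  exact le_antisymm (hs.le_of_mem_slopeRegion hm hr hr' le_rfl hn)
    (hs.le_of_mem_slopeRegion hn hr' hr le_rfl hm)

lemma pathLoss_eq (hs : IsMultiSlope N α R) (Δh : ℝ) {n : ℕ} (hn : n < N) {r : ℝ}
    (hr : r ∈ slopeRegion N R n) :
    pathLoss N α R Δh r = slopeCoeff α R n * antennaDist Δh r ^ (-α n) := by
  rw [pathLoss, Finset.sum_eq_single n]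
  · rw [Set.indicator_of_mem hr]
  · intro m hm hmn
    refine Set.indicator_of_notMem (fun hr' => ?_) _
    exact Set.disjoint_left.1 (hs.pairwiseDisjoint_slopeRegion hm (by simpa using hn) hmn) hr' hr
  · intro h
    exact absurd (Finset.mem_range.2 hn) h

lemma slopeCoeff_mul_rpow_le (hs : IsMultiSlope N α R) {d : ℝ} {m n : ℕ} (hmn : m ≤ n)
    (hn : n < N) (hd0 : 0 < d) (hd : R n ≤ d) :
    slopeCoeff α R n * d ^ (-α n) ≤ slopeCoeff α R m * d ^ (-α m) := by
  induction n, hmn using Nat.le_induction with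
  | base => exact le_rfl
  | succ k hk ih =>
    refine le_trans ?_ (ih (by omega) ((hs.R_lt k hn).le.trans hd))
    have hR := hs.R_pos (Nat.succ_pos k) hn
    have hK := hs.slopeCoeff_pos (n := k) (by omega)
    have hα : 0 ≤ α (k + 1) - α k := sub_nonneg.2 (hs.α_le k hn)
    have h1 : R (k + 1) ^ (α (k + 1) - α k) ≤ d ^ (α (k + 1) - α k) :=
      Real.rpow_le_rpow hR.le hd hα
    have h2 : slopeCoeff α R (k + 1) = slopeCoeff α R k * R (k + 1) ^ (α (k + 1) - α k) := by
      rw [slopeCoeff, Finset.prod_Icc_succ_top (by omega)]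
      rfl
    calc slopeCoeff α R (k + 1) * d ^ (-α (k + 1))
        ≤ slopeCoeff α R k * d ^ (α (k + 1) - α k) * d ^ (-α (k + 1)) := by
          rw [h2]
          gcongr
      _ = slopeCoeff α R k * d ^ (-α k) := by
          rw [mul_assoc, ← Real.rpow_add hd0]
          congr 2
          ring

lemma isPathLoss (hs : IsMultiSlope N α R) {Δh : ℝ} (hΔh : 0 < Δh) :
    IsPathLoss (pathLoss N α R Δh) where
  measurable := by
    unfold pathLoss
    refine Finset.measurable_sum _ fun n _ => ?_
    exact Measurable.indicator (by fun_prop) (measurableSet_slopeRegion N R n)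
  pos r hr := by
    obtain ⟨n, hn, hrn⟩ := hs.exists_mem_slopeRegion hr
    rw [hs.pathLoss_eq Δh hn hrn]
    exact mul_pos (hs.slopeCoeff_pos hn) (Real.rpow_pos_of_pos (antennaDist_pos hΔh r) _)
  nonneg r := by
    refine Finset.sum_nonneg fun n hn => Set.indicator_nonneg (fun r _ => ?_) r
    exact mul_nonneg (hs.slopeCoeff_pos (Finset.mem_range.1 hn)).le
      (Real.rpow_nonneg (antennaDist_pos hΔh r).le _)
  antitoneOn r hr t ht hrt := by
    obtain ⟨m, hm, hrm⟩ := hs.exists_mem_slopeRegion hr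
    obtain ⟨n, hn, htn⟩ := hs.exists_mem_slopeRegion ht
    rw [hs.pathLoss_eq Δh hm hrm, hs.pathLoss_eq Δh hn htn]
    have hmn := hs.le_of_mem_slopeRegion hm hrm htn hrt hn
    refine (hs.slopeCoeff_mul_rpow_le hmn hn (antennaDist_pos hΔh t)
      (htn.1.trans (le_antennaDist Δh t))).trans ?_
    refine mul_le_mul_of_nonneg_left ?_ (hs.slopeCoeff_pos hm).le
    exact Real.rpow_le_rpow_of_nonpos (antennaDist_pos hΔh r) (antennaDist_le hr hrt)
      (neg_nonpos.2 (hs.α_nonneg hm))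

end IsMultiSlope

/-- The chain rule with `d' = t / d` turns `2 d` into `2 t`, so horizontal distance remains the
integration variable. -/
lemma hasDerivAt_boundaryTerm_antennaDist {c a Δh : ℝ} (hc : 0 < c) (ha : 0 ≤ a) (hΔh : 0 < Δh)
    (t : ℝ) : HasDerivAt (fun t => boundaryTerm c a (antennaDist Δh t))
      (2 * t / (1 + antennaDist Δh t ^ a / c)) t := by
  have hd := antennaDist_pos hΔh t
  have := Real.rpow_pos_of_pos hd a
  refine ((hasDerivAt_boundaryTerm hc ha hd).comp t (hasDerivAt_antennaDist hΔh t)).congr_deriv ?_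
  field_simp

/-- Integration of a function that is given slope by slope. -/
lemma integral_Ioi_slopes (hs : IsMultiSlope N α R) {Δh : ℝ} (hΔh : 0 < Δh) {c : ℕ → ℝ}
    (hc : ∀ n < N, 0 < c n) {q : ℝ → ℝ}
    (hq : ∀ n < N, ∀ t ∈ slopeRegion N R n, q t = 2 * t / (1 + antennaDist Δh t ^ α n / c n))
    {i : ℕ} (hi : i < N) :
    ∀ a ∈ slopeRegion N R i, IntegrableOn q (Set.Ioi a) ∧ ∫ t in Set.Ioi a, q t
      = upperTerm N α R Δh i (c i) - boundaryTerm (c i) (α i) (antennaDist Δh a)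
        + ∑ k ∈ Finset.Ico (i + 1) N,
          (upperTerm N α R Δh k (c k) - boundaryTerm (c k) (α k) (antennaDist Δh (R k))) := by
  have hder := fun i (hi : i < N) (t : ℝ) =>
    hasDerivAt_boundaryTerm_antennaDist (hc i hi) (hs.α_nonneg hi) hΔh t
  have hnn : ∀ i < N, ∀ t : ℝ, 0 ≤ t → 0 ≤ 2 * t / (1 + antennaDist Δh t ^ α i / c i) := by
    intro i hi t ht
    have h1 := Real.rpow_nonneg (antennaDist_pos hΔh t).le (α i)
    have h2 := hc i hi
    positivity
  have hle := Nat.le_sub_one_of_lt hi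
  -- Descending induction: the last slope uses the limit at infinity, and every other slope adds its
  -- interval to the ray starting at `R (i + 1)`.
  induction hle using Nat.decreasingInduction with
  | self =>
    intro a ha
    have hnot : ¬ (N - 1 + 1 < N) := by omega
    have ha0 : 0 ≤ a := (hs.R_nonneg hi).trans ha.1
    have hmem : ∀ t ∈ Set.Ioi a, t ∈ slopeRegion N R (N - 1) := fun t ht =>
      ⟨ha.1.trans (le_of_lt ht), fun h => absurd h hnot⟩
    have heq : Set.EqOn q (fun t => 2 * t / (1 + antennaDist Δh t ^ α (N - 1) / c (N - 1)))
        (Set.Ioi a) := fun t ht => hq _ hi t (hmem t ht)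
    have hlim := (tendsto_boundaryTerm_limUnder (hc _ hi) hs.α_last).comp (tendsto_antennaDist Δh)
    have hnn' : ∀ t ∈ Set.Ioi a, 0 ≤ 2 * t / (1 + antennaDist Δh t ^ α (N - 1) / c (N - 1)) :=
      fun t ht => hnn _ hi t (ha0.trans (le_of_lt ht))
    refine ⟨(integrableOn_Ioi_deriv_of_nonneg' (fun t _ => hder _ hi t) hnn' hlim).congr_fun
      heq.symm measurableSet_Ioi, ?_⟩
    rw [setIntegral_congr_fun measurableSet_Ioi heq,
      integral_Ioi_of_hasDerivAt_of_nonneg' (fun t _ => hder _ hi t) hnn' hlim,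
      Finset.Ico_eq_empty hnot, Finset.sum_empty, add_zero, upperTerm, if_neg hnot]
  | of_succ i hiN ih =>
    intro a ha
    have hi1 : i + 1 < N := by omega
    have haR : a < R (i + 1) := ha.2 hi1
    have hRmem : R (i + 1) ∈ slopeRegion N R (i + 1) := ⟨le_rfl, fun h => hs.R_lt _ h⟩
    obtain ⟨hint, hval⟩ := ih hi1 _ hRmem
    -- The interval is open since at `R (i + 1)` the function already follows slope `i + 1`.
    have heq : Set.EqOn q (fun t => 2 * t / (1 + antennaDist Δh t ^ α i / c i))
        (Set.Ioo a (R (i + 1))) := fun t ht => hq i hi t ⟨ha.1.trans ht.1.le, fun _ => ht.2⟩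
    have hcont : Continuous fun t => 2 * t / (1 + antennaDist Δh t ^ α i / c i) := by
      refine Continuous.div (by fun_prop) ?_ fun t => ?_
      · refine continuous_const.add (Continuous.div_const ?_ _)
        exact (continuous_antennaDist Δh).rpow_const fun t => .inl (antennaDist_pos hΔh t).ne'
      · have h1 := Real.rpow_nonneg (antennaDist_pos hΔh t).le (α i)
        have h2 := hc i hi
        positivity
    have hint' : IntegrableOn q (Set.Ioc a (R (i + 1))) := by
      rw [integrableOn_Ioc_iff_integrableOn_Ioo]
      refine IntegrableOn.congr_fun ?_ heq.symm measurableSet_Ioo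
      exact (hcont.integrableOn_Icc).mono_set Set.Ioo_subset_Icc_self
    have hval' : ∫ t in Set.Ioc a (R (i + 1)), q t
        = boundaryTerm (c i) (α i) (antennaDist Δh (R (i + 1)))
          - boundaryTerm (c i) (α i) (antennaDist Δh a) := by
      rw [integral_Ioc_eq_integral_Ioo, setIntegral_congr_fun measurableSet_Ioo heq,
        ← integral_Ioc_eq_integral_Ioo, ← intervalIntegral.integral_of_le haR.le]
      exact intervalIntegral.integral_eq_sub_of_hasDerivAt (fun t _ => hder i hi t)
        (hcont.intervalIntegrable _ _)
    have hU : upperTerm N α R Δh i (c i)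
        = boundaryTerm (c i) (α i) (antennaDist Δh (R (i + 1))) := if_pos hi1
    rw [← Set.Ioc_union_Ioi_eq_Ioi haR.le]
    refine ⟨hint'.union hint, ?_⟩
    rw [setIntegral_union (Set.Ioc_disjoint_Ioi le_rfl) measurableSet_Ioi hint' hint, hval, hval',
      Finset.sum_eq_sum_Ico_succ_bot hi1, hU]

end

/-! ### Evaluation of the Laplace exponent and the coverage formulas. -/

section

variable {N : ℕ} {α R : ℕ → ℝ}

/-- The Laplace exponent of the interference beyond distance `r`. -/
def interferenceExponent (lam : ℝ) (l : ℝ → ℝ) (τ r : ℝ) : ℝ≥0∞ :=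
  ∫⁻ t, (1 - expNeg ((Set.Ioi r).indicator (interferenceKernel l τ r) t)) ∂(radialIntensity lam)

lemma IsPathLoss.measurable_interferenceExponent {l : ℝ → ℝ} (hl : IsPathLoss l) (lam τ : ℝ) :
    Measurable (interferenceExponent lam l τ) := by
  have h1 : Measurable fun p : ℝ × ℝ =>
      (Set.Ioi p.1).indicator (interferenceKernel l τ p.1) p.2 := by
    have : (fun p : ℝ × ℝ => (Set.Ioi p.1).indicator (interferenceKernel l τ p.1) p.2)
        = {p : ℝ × ℝ | p.1 < p.2}.indicator (Function.uncurry (interferenceKernel l τ)) := by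
      ext ⟨r, t⟩
      rfl
    rw [this]
    exact (hl.measurable_interferenceKernel τ).indicator
      (measurableSet_lt measurable_fst measurable_snd)
  exact Measurable.lintegral_prod_right' (f := fun p : ℝ × ℝ =>
    1 - expNeg ((Set.Ioi p.1).indicator (interferenceKernel l τ p.1) p.2))
    (measurable_const.sub (measurable_expNeg.comp h1))

lemma IsPathLoss.one_sub_expNeg_interferenceKernel {l : ℝ → ℝ} (hl : IsPathLoss l) {τ : ℝ}
    (hτ : 0 < τ) {r t : ℝ} (hr : 0 ≤ r) (ht : 0 ≤ t) :
    1 - expNeg (interferenceKernel l τ r t) = ENNReal.ofReal (1 / (1 + l r / (τ * l t))) := by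
  have h1 := hl.pos r hr
  have h2 := hl.pos t ht
  have h3 : 0 < τ * l t / l r := by positivity
  rw [interferenceKernel, expNeg_ofReal (Real.log_nonneg (by linarith)), Real.exp_neg,
    Real.exp_log (by positivity), ← ENNReal.ofReal_one, ← ENNReal.ofReal_sub _ (by positivity)]
  congr 1
  field_simp
  ring

lemma IsPathLoss.interferenceExponent_eq {l : ℝ → ℝ} (hl : IsPathLoss l) {lam τ : ℝ}
    (hlam : 0 < lam) (hτ : 0 < τ) {r : ℝ} (hr : 0 ≤ r)
    (hint : IntegrableOn (fun t => 2 * t / (1 + l r / (τ * l t))) (Set.Ioi r)) :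
    interferenceExponent lam l τ r
      = ENNReal.ofReal (Real.pi * lam * ∫ t in Set.Ioi r, 2 * t / (1 + l r / (τ * l t))) := by
  have hpl : 0 < Real.pi * lam := mul_pos Real.pi_pos hlam
  have hlm := hl.measurable
  have h1 := hl.pos r hr
  have hnn : ∀ t ∈ Set.Ioi r, 0 ≤ 2 * t / (1 + l r / (τ * l t)) := by
    intro t ht
    have ht0 : 0 ≤ t := hr.trans (le_of_lt ht)
    have h2 := hl.pos t ht0
    positivity
  have hk : Measurable (interferenceKernel l τ r) :=
    (hl.measurable_interferenceKernel τ).of_uncurry_left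
  have hF : Measurable fun t =>
      1 - expNeg ((Set.Ioi r).indicator (interferenceKernel l τ r) t) :=
    measurable_const.sub (measurable_expNeg.comp (hk.indicator measurableSet_Ioi))
  rw [ENNReal.ofReal_mul hpl.le, ofReal_integral_eq_lintegral_ofReal hint
    ((ae_restrict_iff' measurableSet_Ioi).2 (ae_of_all _ hnn)),
    ← lintegral_const_mul _ (by fun_prop), interferenceExponent, radialIntensity,
    lintegral_withDensity_eq_lintegral_mul _ (by fun_prop) hF,
    ← lintegral_indicator measurableSet_Ici, ← lintegral_indicator measurableSet_Ioi]
  refine lintegral_congr fun t => ?_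
  by_cases ht : t ∈ Set.Ioi r
  · have ht0 : 0 ≤ t := hr.trans (le_of_lt ht)
    rw [Set.indicator_of_mem (s := Set.Ici 0) ht0, Set.indicator_of_mem ht, Pi.mul_apply,
      Set.indicator_of_mem ht, hl.one_sub_expNeg_interferenceKernel hτ hr ht0,
      ← ENNReal.ofReal_mul (by positivity), ← ENNReal.ofReal_mul hpl.le]
    congr 1
    ring
  · rw [Set.indicator_of_notMem ht]
    by_cases ht0 : t ∈ Set.Ici (0 : ℝ)
    · rw [Set.indicator_of_mem ht0, Pi.mul_apply, Set.indicator_of_notMem ht]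
      simp
    · rw [Set.indicator_of_notMem ht0]

/-- The Laplace exponent for the multi-slope path loss. -/
lemma IsMultiSlope.expNeg_interferenceExponent (hs : IsMultiSlope N α R) {Δh lam τ : ℝ}
    (hΔh : 0 < Δh) (hlam : 0 < lam) (hτ : 0 < τ) {n : ℕ} (hn : n < N) {r : ℝ}
    (hr : r ∈ slopeRegion N R n) :
    expNeg (interferenceExponent lam (pathLoss N α R Δh) τ r)
      = ENNReal.ofReal (coverageIntegrand N α R Δh lam τ n r) := by
  have hl := hs.isPathLoss hΔh
  have hr0 : 0 ≤ r := (hs.R_nonneg hn).trans hr.1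
  have hd := antennaDist_pos hΔh r
  set d := antennaDist Δh r with hd_def
  have hda := Real.rpow_pos_of_pos hd (α n)
  have hKn := hs.slopeCoeff_pos hn
  -- Chosen so that `l(r) / (τ l(t)) = antennaDist Δh t ^ α k / c k` for `t` in slope region `k`.
  let c : ℕ → ℝ := fun k => τ * (slopeCoeff α R k / slopeCoeff α R n) * d ^ α n
  have hc : ∀ k < N, 0 < c k := fun k hk => by
    have := hs.slopeCoeff_pos hk
    positivity
  have hcn : c n = τ * d ^ α n := by
    simp only [c]
    rw [div_self hKn.ne', mul_one]
  have hq : ∀ k < N, ∀ t ∈ slopeRegion N R k,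
      2 * t / (1 + pathLoss N α R Δh r / (τ * pathLoss N α R Δh t))
        = 2 * t / (1 + antennaDist Δh t ^ α k / c k) := by
    intro k hk t ht
    have hKk := hs.slopeCoeff_pos hk
    have hdt := antennaDist_pos hΔh t
    have hdta := Real.rpow_pos_of_pos hdt (α k)
    rw [hs.pathLoss_eq Δh hn hr, hs.pathLoss_eq Δh hk ht, Real.rpow_neg hd.le, Real.rpow_neg hdt.le]
    congr 2
    simp only [c]
    field_simp
  obtain ⟨hint, hval⟩ := integral_Ioi_slopes hs hΔh hc hq hn r hr
  have hexp : ∫ t in Set.Ioi r, 2 * t / (1 + pathLoss N α R Δh r / (τ * pathLoss N α R Δh t))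
      = coverageExponent N α R Δh τ n d := by
    have hB : boundaryTerm (c n) (α n) d = d ^ 2 * omega2 τ⁻¹ (α n) := by
      rw [boundaryTerm, hcn]
      congr 2
      field_simp
    rw [hval, ← hd_def, hB, hcn, coverageExponent]
  have hnn : 0 ≤ coverageExponent N α R Δh τ n d := by
    rw [← hexp]
    refine setIntegral_nonneg measurableSet_Ioi fun t ht => ?_
    have ht0 : 0 ≤ t := hr0.trans (le_of_lt ht)
    have h1 := hl.pos t ht0
    have h2 := hl.pos r hr0
    positivity
  rw [hl.interferenceExponent_eq hlam hτ hr0 hint, hexp,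
    expNeg_ofReal (mul_nonneg (mul_nonneg Real.pi_pos.le hlam.le) hnn), coverageIntegrand,
    ← hd_def]
  congr 2
  ring

/-- On the region the integrand equals `exp` of minus the Laplace exponent, which is measurable and
at most 1; measurability of the hypergeometric expression is never needed. -/
lemma IsMultiSlope.integrableOn_coverageIntegrand (hs : IsMultiSlope N α R) {Δh lam τ : ℝ}
    (hΔh : 0 < Δh) (hlam : 0 < lam) (hτ : 0 < τ) {n : ℕ} (hn : n < N) :
    IntegrableOn (coverageIntegrand N α R Δh lam τ n) (slopeRegion N R n) (contactLaw lam) := by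
  have := isProbabilityMeasure_contactLaw hlam
  have hl := hs.isPathLoss hΔh
  have heq : Set.EqOn (fun r => (expNeg (interferenceExponent lam (pathLoss N α R Δh) τ r)).toReal)
      (coverageIntegrand N α R Δh lam τ n) (slopeRegion N R n) := by
    intro r hr
    simp only [hs.expNeg_interferenceExponent hΔh hlam hτ hn hr]
    exact ENNReal.toReal_ofReal (Real.exp_pos _).le
  refine IntegrableOn.congr_fun ?_ heq (measurableSet_slopeRegion N R n)
  refine Integrable.integrableOn (Integrable.of_bound (C := 1) ?_ (ae_of_all _ fun r => ?_))
  · exact (measurable_expNeg.comp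
      (hl.measurable_interferenceExponent lam τ)).ennreal_toReal.aestronglyMeasurable
  · rw [Real.norm_of_nonneg ENNReal.toReal_nonneg]
    exact ENNReal.toReal_le_of_le_ofReal zero_le_one (by simpa using expNeg_le_one _)

lemma IsMultiSlope.lintegral_expNeg_interferenceExponent (hs : IsMultiSlope N α R) {Δh lam τ : ℝ}
    (hΔh : 0 < Δh) (hlam : 0 < lam) (hτ : 0 < τ) :
    (∫⁻ r, expNeg (interferenceExponent lam (pathLoss N α R Δh) τ r) ∂(contactLaw lam)).toReal
      = ∑ n ∈ Finset.range N, ∫ r in slopeRegion N R n,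
          coverageIntegrand N α R Δh lam τ n r ∂(contactLaw lam) := by
  have hcover : ∀ᵐ r ∂(contactLaw lam), r ∈ ⋃ n ∈ Finset.range N, slopeRegion N R n := by
    filter_upwards [ae_contactLaw_nonneg lam] with r hr
    obtain ⟨n, hn, hrn⟩ := hs.exists_mem_slopeRegion hr
    exact Set.mem_biUnion (Finset.mem_coe.2 (Finset.mem_range.2 hn)) hrn
  rw [← Measure.restrict_eq_self_of_ae_mem hcover, lintegral_biUnion_finset
    hs.pairwiseDisjoint_slopeRegion fun n _ => measurableSet_slopeRegion N R n,
    Measure.restrict_eq_self_of_ae_mem hcover]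
  have hterm : ∀ n ∈ Finset.range N, ∫⁻ r in slopeRegion N R n,
      expNeg (interferenceExponent lam (pathLoss N α R Δh) τ r) ∂(contactLaw lam)
      = ENNReal.ofReal (∫ r in slopeRegion N R n,
          coverageIntegrand N α R Δh lam τ n r ∂(contactLaw lam)) := by
    intro n hn
    have hn' := Finset.mem_range.1 hn
    rw [ofReal_integral_eq_lintegral_ofReal
      (hs.integrableOn_coverageIntegrand hΔh hlam hτ hn') (ae_of_all _ fun r => (Real.exp_pos _).le)]
    exact setLIntegral_congr_fun (measurableSet_slopeRegion N R n) fun r hr =>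
      hs.expNeg_interferenceExponent hΔh hlam hτ hn' hr
  rw [Finset.sum_congr rfl hterm, ENNReal.toReal_sum fun n _ => ENNReal.ofReal_ne_top]
  exact Finset.sum_congr rfl fun n _ =>
    ENNReal.toReal_ofReal (integral_nonneg fun r => (Real.exp_pos _).le)

lemma delta_nonneg {τ a : ℝ} (hτ : 0 < τ) (ha : 2 < a) : 0 ≤ delta τ a := by
  have h1 := sq_mul_delta_eq hτ ha one_pos
  rw [Real.one_rpow, div_one, one_pow, one_mul] at h1
  rw [h1]
  refine mul_nonneg (by positivity) (intervalIntegral.integral_nonneg hτ.le fun v hv => ?_)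
  have := hv.1
  positivity

lemma IsMultiSlope.lintegral_expNeg_interferenceExponent_one (hs : IsMultiSlope 1 α R)
    {Δh lam τ : ℝ} (hΔh : 0 < Δh) (hlam : 0 < lam) (hτ : 0 < τ) :
    (∫⁻ r, expNeg (interferenceExponent lam (pathLoss 1 α R Δh) τ r) ∂(contactLaw lam)).toReal
      = 1 / (1 + delta τ (α 0)) * Real.exp (-Real.pi * lam * delta τ (α 0) * Δh ^ 2) := by
  have ha : 2 < α 0 := hs.α_last
  have hδ := delta_nonneg hτ ha
  have h1 : ∀ r, 0 ≤ r → expNeg (interferenceExponent lam (pathLoss 1 α R Δh) τ r)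
      = ENNReal.ofReal (Real.exp (-Real.pi * lam * delta τ (α 0) * Δh ^ 2))
        * ENNReal.ofReal (Real.exp (-(Real.pi * lam * delta τ (α 0) * r ^ 2))) := by
    intro r hr
    have hr' : r ∈ slopeRegion 1 R 0 := ⟨hs.R_zero.le.trans hr, fun h => absurd h (by omega)⟩
    have hd := antennaDist_pos hΔh r
    have hda := Real.rpow_pos_of_pos hd (α 0)
    have hexp : coverageExponent 1 α R Δh τ 0 (antennaDist Δh r)
        = antennaDist Δh r ^ 2 * delta τ (α 0) := by
      have hc : 0 < τ * antennaDist Δh r ^ α 0 := by positivity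
      have h2 : antennaDist Δh r ^ α 0 / (τ * antennaDist Δh r ^ α 0) = τ⁻¹ := by field_simp
      have h3 : τ * antennaDist Δh r ^ α 0 / antennaDist Δh r ^ α 0 = τ := by field_simp
      -- Evaluating the limit at `S = d` cancels the lower boundary term and leaves `d ^ 2 * delta τ
      -- (α 0)`.
      rw [coverageExponent, upperTerm, if_neg (by omega), limUnder_boundaryTerm hc ha hd,
        boundaryTerm, h2, h3]
      simp
    -- From `d² = r² + Δh²`, the height gives a constant factor and `r²` is left to the contact
    -- average.
    rw [hs.expNeg_interferenceExponent hΔh hlam hτ one_pos hr', coverageIntegrand, hexp,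
      sq_antennaDist, ← ENNReal.ofReal_mul (Real.exp_pos _).le, ← Real.exp_add]
    congr 2
    ring
  rw [lintegral_congr_ae (by
      filter_upwards [ae_contactLaw_nonneg lam] with r hr using h1 r hr),
    lintegral_const_mul _ (by fun_prop), lintegral_exp_contactLaw hlam hδ, ENNReal.toReal_mul,
    ENNReal.toReal_ofReal (Real.exp_pos _).le, ENNReal.toReal_ofReal (by positivity), mul_comm]

end

end SmallCell

end

theorem proposition1 {Ω : Type*} [MeasurableSpace Ω] (μ : Measure Ω) [IsProbabilityMeasure μ]
    (lam P τ Δh : ℝ) (hlam : 0 < lam) (hP : 0 < P) (hτ : 0 < τ) (hΔh : 0 < Δh)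
    (N : ℕ) (α R : ℕ → ℝ) (hslope : SmallCell.IsMultiSlope N α R)
    (X : ℕ → Ω → SmallCell.Plane) (h : ℕ → Ω → ℂ) (hnet : SmallCell.IsNetwork μ lam X h)
    (u : SmallCell.Plane) :
    -- the distance to the nearest base station follows the contact distribution
    HasLaw (fun ω => ⨅ i, dist (X i ω) u) (SmallCell.contactLaw lam) μ ∧
    -- spatial throughput
    SmallCell.spatialThroughput μ lam X h u P (SmallCell.pathLoss N α R Δh) τ
      = lam * SmallCell.coverageProb μ X h u P (SmallCell.pathLoss N α R Δh) τ
          * Real.logb 2 (1 + τ) ∧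
    -- one slope
    (N = 1 → SmallCell.coverageProb μ X h u P (SmallCell.pathLoss N α R Δh) τ
      = 1 / (1 + SmallCell.delta τ (α 0))
          * Real.exp (-Real.pi * lam * SmallCell.delta τ (α 0) * Δh ^ 2)) ∧
    -- several slopes: the limits at infinity exist, the expectations are finite, and the formula
    (1 < N →
      (∀ c : ℝ, 0 < c → Tendsto (SmallCell.boundaryTerm c (α (N - 1))) atTop
        (𝓝 (limUnder atTop (SmallCell.boundaryTerm c (α (N - 1)))))) ∧
      (∀ n < N, IntegrableOn (SmallCell.coverageIntegrand N α R Δh lam τ n)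
        (SmallCell.slopeRegion N R n) (SmallCell.contactLaw lam)) ∧
      SmallCell.coverageProb μ X h u P (SmallCell.pathLoss N α R Δh) τ
        = ∑ n ∈ Finset.range N, ∫ r₀ in SmallCell.slopeRegion N R n,
            SmallCell.coverageIntegrand N α R Δh lam τ n r₀ ∂(SmallCell.contactLaw lam)) := by

  have hl := hslope.isPathLoss hΔh
  have hcov := hnet.coverageProb_eq hlam hP hτ hl u
  refine ⟨hnet.ppp.hasLaw_nearestDist hlam u, ?_, ?_, ?_⟩
  · rw [SmallCell.spatialThroughput]
  · rintro rfl
    exact hcov.trans (hslope.lintegral_expNeg_interferenceExponent_one hΔh hlam hτ)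
  · intro _
    exact ⟨fun c hc => SmallCell.tendsto_boundaryTerm_limUnder hc hslope.α_last,
      fun n hn => hslope.integrableOn_coverageIntegrand hΔh hlam hτ hn,
      hcov.trans (hslope.lintegral_expNeg_interferenceExponent hΔh hlam hτ)⟩
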